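/- Let $G$ be an infinite finitely generated group, regarded as a metric space via the word metric with respect to some finite generating set. If $G$ acts properly and co-compactly (by cubical automorphisms) on a CAT(0) cube complex, then $G$ has Hilbert space compression $1$. Here a cube complex is a space glued from Euclidean unit cubes by isometries between their faces, with the quotient topology; it is CAT(0) if it is simply connected and non-positively curved, i.e. for every cube $C$ the link of $C$ has no loops and no bigons (every edge of the link has two distinct vertices, and two vertices of the link are joined by at most one edge) and every edge cycle of length three in the link of $C$ is contained in a $2$-simplex of the link. The action is proper if for all compact sets $K,L$ only finitely many $g\in G$ satisfy $gK\cap L\neq\emptyset$, and co-compact if the translates of some compact set cover the complex. A map $f:A\to B$ of metric spaces is large-scale Lipschitz if there are $C>0$, $D\ge 0$ with $d_B(f(x),f(y))\le C\,d_A(x,y)+D$ for all $x,y\in A$. For an unbounded metric space $A$ and $f:A\to B$ put $\rho_f(r)=\inf\{d_B(f(x),f(y)) : d_A(x,y)\ge r\}$; the asymptotic compression of $f$ is $R_f=\liminf_{r\to\infty}\frac{\log\max\{\rho_f(r),1\}}{\log r}$. The Hilbert space compression of $A$ is the supremum of $R_f$ over all large-scale Lipschitz maps $f$ from $A$ to Hilbert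 spaces. -/

import Mathlib

open Set Filter Topology
open scoped unitInterval

universe u v w

/-! ### Cube complexes -/

/-- The standard `n`-cube `[0,1]^n` (isometric to `[-1/2,1/2]^n`). -/
abbrev Cube (n : ℕ) : Type := Fin n → I

/-- The open cube `(0,1)^n`; it is the one-point cube when `n = 0`. -/
def cubeInterior (n : ℕ) : Set (Cube n) := {x | ∀ i, 0 < x i ∧ x i < 1}

/-- `f : [0,1]^m → [0,1]^n` is an isometry onto an `m`-dimensional face of the `n`-cube: every
coordinate of `x` is placed, possibly reversed, in its own coordinate of `f x`, and all the other
coordinates of `f x` are constant, equal to `0` or to `1`. For `m = n` these are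
exactly the symmetries of the cube. -/
def IsFaceMap {m n : ℕ} (f : Cube m → Cube n) : Prop :=
  ∃ e : Fin m ↪ Fin n,
    (∀ i, (∀ x, f x (e i) = x i) ∨ (∀ x, f x (e i) = σ (x i))) ∧
    (∀ j, j ∉ range e → (∀ x, f x j = 0) ∨ (∀ x, f x j = 1))

/-- A cube complex structure on a space `X`: a space glued from Euclidean cubes by isometries
between their faces. It is given by all the parametrizations `[0,1]^n → X` of its cubes (so that an
`n`-dimensional cube of `X` contributes one parametrization for each symmetry of `[0,1]^n`).
Cubes need not be embedded, and the dimension need not be bounded. -/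
structure CubeComplex (X : Type w) [TopologicalSpace X] where
  /-- the parametrized `n`-cubes of the complex -/
  cubes : (n : ℕ) → Set (Cube n → X)
  /-- faces of cubes are cubes, and cubes may be reparametrized by symmetries -/
  comp_mem : ∀ {m n : ℕ} {c : Cube n → X} {f : Cube m → Cube n},
    c ∈ cubes n → IsFaceMap f → c ∘ f ∈ cubes m
  /-- every point lies in an open cube -/
  exists_cube : ∀ p : X, ∃ n, ∃ c ∈ cubes n, ∃ x ∈ cubeInterior n, c x = p
  /-- open cubes are embedded -/
  injOn : ∀ {n : ℕ} {c : Cube n → X}, c ∈ cubes n → InjOn c (cubeInterior n)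
  /-- open cubes that meet are equal, and their parametrizations differ by an isometry -/
  eq_comp : ∀ {m n : ℕ} {c : Cube n → X} {d : Cube m → X}, c ∈ cubes n → d ∈ cubes m →
    ∀ x ∈ cubeInterior n, ∀ y ∈ cubeInterior m, c x = d y →
      ∃ f : Cube m → Cube n, IsFaceMap f ∧ f y = x ∧ d = c ∘ f
  /-- `X` carries the quotient topology from the disjoint union of the cubes -/
  isOpen_iff : ∀ U : Set X, IsOpen U ↔ ∀ n, ∀ c ∈ cubes n, IsOpen (c ⁻¹' U)

/-- The inclusion of `[0,1]^n` in `[0,1]^(n+1)` as the face `x_i = 0`. -/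
def faceZero {n : ℕ} (i : Fin (n + 1)) (x : Cube n) : Cube (n + 1) :=
  Fin.insertNth (α := fun _ => I) i 0 x

namespace CubeComplex

variable {X : Type w} [TopologicalSpace X]

/-- The vertices of the link of the `k`-cube `c`: the `(k+1)`-cubes at `c`, each with an
identification of one of its faces with `c`. They are parametrized so that this face is `x_0 = 0`,
with `c` as its parametrization, which makes the parametrization unique. -/
def LinkVertex (K : CubeComplex X) {k : ℕ} (c : Cube k → X) (a : Cube (k + 1) → X) : Prop :=
  a ∈ K.cubes (k + 1) ∧ a ∘ faceZero 0 = c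

/-- `s` is an edge from `a` to `b` in the link of `c`, where `a`, `b` are vertices of that link:
a `(k+2)`-cube which contains `c` as the face `x_0 = x_1 = 0`, and has `a` as the face
`x_1 = 0` and `b` as the face `x_0 = 0`. -/
def LinkEdge (K : CubeComplex X) {k : ℕ} (a b : Cube (k + 1) → X) (s : Cube (k + 2) → X) : Prop :=
  s ∈ K.cubes (k + 2) ∧ s ∘ faceZero 1 = a ∧ s ∘ faceZero 0 = b

/-- Gromov's conditions on the link of every cube of the complex. -/
structure NonpositivelyCurved (K : CubeComplex X) : Prop where
  /-- the edges of a link have two distinct vertices -/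
  no_loops : ∀ {k : ℕ} {c : Cube k → X} {a : Cube (k + 1) → X} {s : Cube (k + 2) → X},
    c ∈ K.cubes k → K.LinkVertex c a → ¬ K.LinkEdge a a s
  /-- two vertices of a link span at most one edge -/
  no_bigons : ∀ {k : ℕ} {c : Cube k → X} {a b : Cube (k + 1) → X} {s t : Cube (k + 2) → X},
    c ∈ K.cubes k → K.LinkVertex c a → K.LinkVertex c b →
      K.LinkEdge a b s → K.LinkEdge a b t → s = t
  /-- every edge cycle of length three in a link bounds a 2-simplex of the link, that is,
  a `(k+3)`-cube containing `c` as the face `x_0 = x_1 = x_2 = 0` -/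
  no_triangles : ∀ {k : ℕ} {c : Cube k → X} {a₀ a₁ a₂ : Cube (k + 1) → X}
    {s₀₁ s₁₂ s₀₂ : Cube (k + 2) → X}, c ∈ K.cubes k →
      K.LinkVertex c a₀ → K.LinkVertex c a₁ → K.LinkVertex c a₂ →
      K.LinkEdge a₀ a₁ s₀₁ → K.LinkEdge a₁ a₂ s₁₂ → K.LinkEdge a₀ a₂ s₀₂ →
      ∃ q ∈ K.cubes (k + 3),
        q ∘ faceZero 2 = s₀₁ ∧ q ∘ faceZero 0 = s₁₂ ∧ q ∘ faceZero 1 = s₀₂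

/-- A cube complex is CAT(0) if it is simply connected and nonpositively curved. -/
structure IsCAT0 (K : CubeComplex X) : Prop where
  simplyConnected : SimplyConnectedSpace X
  nonpositivelyCurved : K.NonpositivelyCurved

/-- The action of `G` on `X` is an action on the cube complex: each group element
maps cubes isometrically onto cubes. -/
def IsCubicalAction (K : CubeComplex X) (G : Type u) [Group G] [MulAction G X] : Prop :=
  ∀ (g : G) (n : ℕ), ∀ c ∈ K.cubes n, (fun x => g • c x) ∈ K.cubes n

end CubeComplex

/-- The action is co-compact: the translates of some compact set cover the space. -/
def IsCocompactAction (G : Type u) (X : Type w) [Group G] [TopologicalSpace X] [MulAction G X] :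
    Prop :=
  ∃ C : Set X, IsCompact C ∧ ⋃ g : G, (fun x => g • x) '' C = univ

/-! ### Word metrics -/

theorem mulCayley_connected {G : Type u} [Group G] (S : Set G) (hS : Subgroup.closure S = ⊤) :
    (SimpleGraph.mulCayley S).Connected := by
  have step : ∀ x s : G, s ∈ S → (SimpleGraph.mulCayley S).Reachable x (x * s) := by
    intro x s hs
    by_cases h : x = x * s
    · rw [← h]
    · exact SimpleGraph.Adj.reachable
        ((SimpleGraph.mulCayley_adj' S _ _).2 ⟨h, s, hs, Or.inl rfl⟩)
  have key : ∀ g : G, ∀ x : G, (SimpleGraph.mulCayley S).Reachable x (x * g) := by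
    intro g
    have hg : g ∈ Subgroup.closure S := by rw [hS]; trivial
    induction hg using Subgroup.closure_induction with
    | mem s hs => exact fun x => step x s hs
    | one => intro x; rw [mul_one]
    | mul a b _ _ iha ihb => intro x; rw [← mul_assoc]; exact (iha x).trans (ihb _)
    | inv a _ iha => intro x; simpa using (iha (x * a⁻¹)).symm
  have : Nonempty G := ⟨1⟩
  refine SimpleGraph.Connected.mk fun x y => ?_
  simpa using key (x⁻¹ * y) x

/-- The word metric on `G` with respect to the generating set `S`: the edge metric on the vertices
of the Cayley graph. -/
noncomputable abbrev wordMetric {G : Type u} [Group G] (S : Set G)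
    (hS : Subgroup.closure S = ⊤) : MetricSpace G where
  dist x y := ((SimpleGraph.mulCayley S).dist x y : ℝ)
  dist_self x := by simp
  dist_comm x y := by rw [SimpleGraph.dist_comm]
  dist_triangle x y z := by exact_mod_cast (mulCayley_connected S hS).dist_triangle
  eq_of_dist_eq_zero {x y} h :=
    (mulCayley_connected S hS).dist_eq_zero_iff.1 (by exact_mod_cast h)

/-! ### Hilbert space compression -/

section Compression

variable {A : Type u} {B : Type v} [MetricSpace A] [MetricSpace B]

/-- Large-scale Lipschitz maps. -/
def LargeScaleLipschitz (f : A → B) : Prop :=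
  ∃ C D : ℝ, 0 < C ∧ 0 ≤ D ∧ ∀ x y, dist (f x) (f y) ≤ C * dist x y + D

/-- The compression function `ρ_f(r) = inf {d(f x, f y) | d(x, y) ≥ r}` (of a map on an unbounded
space, so that the infimum is over a nonempty set). -/
noncomputable def compressionFun (f : A → B) (r : ℝ) : ℝ :=
  sInf {t | ∃ x y, r ≤ dist x y ∧ t = dist (f x) (f y)}

/-- The asymptotic compression `R_f = liminf_{r → ∞} log (max (ρ_f(r), 1)) / log r` of a map on an
unbounded space. The lower limit is taken in the extended reals. -/
noncomputable def asymptoticCompression (f : A → B) : EReal :=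
  liminf (fun r : ℝ => ((Real.log (max (compressionFun f r) 1) / Real.log r : ℝ) : EReal)) atTop

end Compression

/-- The Hilbert space compression of an unbounded metric space `A`: the supremum, in the extended
reals, of the asymptotic compressions of all large-scale Lipschitz maps from `A` to
Hilbert spaces. -/
noncomputable def hilbertSpaceCompression (A : Type u) [MetricSpace A] : EReal :=
  sSup {R | ∃ (H : Type v) (_ : NormedAddCommGroup H) (_ : InnerProductSpace ℝ H)
    (_ : CompleteSpace H) (f : A → H), LargeScaleLipschitz f ∧ R = asymptoticCompression f}

/-!
The upper bound is elementary: in the word metric of an infinite group every natural number occurs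
as a distance, so the compression function of a large-scale Lipschitz map grows at most linearly.
The lower bound comes from maps to Hilbert spaces that are defined by the walls (hyperplanes) of the
cube complex.

*Walls.* Only the oriented edges and the squares matter, together with the conditions on links of
vertices (`FlagSquareComplex`). Consider words of edges modulo swaps of two consecutive sides of a
square for the other two. The link conditions say that two first letters of such a class span a
square (`FlagSquareComplex.cons_eq_cons`). Hence the edges act by permutations on the classes without
backtracks, by prepending or cancelling, and the two ways around a square act in the same way
(`FlagSquareComplex.Sq.act_comm`). In a simply connected complex this action has no holonomy, so that
reduced paths with the same ends differ by swaps (`FlagSquareComplex.SimplyConn.trace_eq`), as in van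
der Waerden's proof of the normal form in free products. It follows that reduced paths are those that
cross every wall at most once (`FlagSquareComplex.SimplyConn.nodup`), that every wall has two sides,
and that the combinatorial distance is the number of separating walls
(`FlagSquareComplex.SimplyConn.ncard_sep`).

*Simple connectedness.* The combinatorial argument needs that every flat cocycle on the edges with
values in a group is a coboundary. A cocycle defines a covering space of the cube complex, glued by
parallel transport in the cubes over neighbourhoods of points; a simply connected and locally path
connected space admits a global section of it, and this section is the required function
(`CubeComplex.IsCocycle.exists_coboundary`, `CubeComplex.IsCAT0.simplyConn`).

*The embedding.* Fix a base vertex `x₀`. The weight of a wall `h` between `x` and `x₀`, seen from `x`,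
is the number of walls whose halfspace containing `x` lies in that of `h`. Walls of the same weight
have incomparable halfspaces, and there are at most as many such walls as edges at a vertex
(`FlagSquareComplex.SimplyConn.card_antichain_le`), a number which is bounded since the action is
proper and cocompact. Send `x` to the vector with coordinate `weight ^ ε` at the walls
between `x` and `x₀`, and `0` elsewhere. A step along an edge changes the other weights by at most
one, so the square of the displacement is bounded by a multiple of `∑ n ^ (2 * ε - 2)`, which is
finite for `ε < 1 / 2`. If `n` walls separate `x` from `y`, half of them have a zero coordinate at one
of the two points and a positive power of the weight at the other, and most of these weights are at
least a multiple of `n`; so the images are at distance at least a multiple of `n ^ (ε + 1 / 2)`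
(`FlagSquareComplex.SimplyConn.exists_hilbert_embedding`).

*The group.* An orbit map from the group to the vertices distorts distances by affine functions at
most (`CubeComplex.exists_dist_le`, the Švarc–Milnor argument), so that the compression is at least
`ε + 1 / 2` for every `ε < 1 / 2`.
-/

/-! ### Flag square complexes -/

/-- The combinatorial shadow of a nonpositively curved cube complex in dimension two: oriented edges
with an orientation reversal, and squares. `Sq a b a' b'` says that `a` and `b` issue from one
corner of a square in which `a'` is opposite to `a` and `b'` is opposite to `b`, so that the paths
`a b'` and `b a'` have the same ends. The last three fields are Gromov's conditions on
links of vertices, the third one in the form of the square faces of the 3-cube. -/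
structure FlagSquareComplex (V : Type*) (E : Type w) where
  /-- the initial vertex of an oriented edge -/
  src : E → V
  /-- the terminal vertex of an oriented edge -/
  tgt : E → V
  /-- orientation reversal -/
  inv : E → E
  /-- the squares, with a marked corner and an order of the two edges there -/
  Sq : E → E → E → E → Prop
  inv_inv : ∀ e, inv (inv e) = e
  src_inv : ∀ e, src (inv e) = tgt e
  src_eq : ∀ {a b a' b'}, Sq a b a' b' → src a = src b
  tgt_eq : ∀ {a b a' b'}, Sq a b a' b' → tgt a = src b'
  tgt_eq' : ∀ {a b a' b'}, Sq a b a' b' → tgt a' = tgt b'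
  symm : ∀ {a b a' b'}, Sq a b a' b' → Sq b a b' a'
  rot : ∀ {a b a' b'}, Sq a b a' b' → Sq (inv a) b' (inv a') b
  ne : ∀ {a b a' b'}, Sq a b a' b' → a ≠ b
  uniq : ∀ {a b a₁ b₁ a₂ b₂}, Sq a b a₁ b₁ → Sq a b a₂ b₂ → a₁ = a₂ ∧ b₁ = b₂
  cube : ∀ {a b c a₁ b₁ b₂ c₂ a₃ c₃}, Sq a b a₁ b₁ → Sq b c b₂ c₂ → Sq a c a₃ c₃ →
    ∃ a' b' c', Sq b₁ c₃ b' c' ∧ Sq a₁ c₂ a' c' ∧ Sq a₃ b₂ a' b'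

namespace FlagSquareComplex

variable {V : Type*} {E : Type w} (C : FlagSquareComplex V E)

theorem tgt_inv (e : E) : C.tgt (C.inv e) = C.src e := by
  rw [← C.src_inv, C.inv_inv]

variable {C} in
theorem Sq.flip {a b a' b' : E} (h : C.Sq a b a' b') : C.Sq a' (C.inv b) a (C.inv b') :=
  C.symm (C.rot (C.symm h))

variable {C} in
theorem Sq.opp {a b a' b' : E} (h : C.Sq a b a' b') :
    C.Sq (C.inv b') (C.inv a') (C.inv b) (C.inv a) :=
  C.rot (C.symm (C.rot h))

/-! ### Edge words modulo square swaps -/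

/-- An elementary move on words of edges: two consecutive sides of a square are replaced with the
other two. -/
inductive Step : List E → List E → Prop
  | head {a b a' b' : E} (w : List E) : C.Sq a b a' b' → Step (a :: b' :: w) (b :: a' :: w)
  | cons (e : E) {w w' : List E} : Step w w' → Step (e :: w) (e :: w')

variable {C} in
theorem Step.symm {w w' : List E} (h : C.Step w w') : C.Step w' w := by
  induction h with
  | head w h => exact .head w (C.symm h)
  | cons e _ ih => exact .cons e ih

variable {C} in
theorem Step.length_eq {w w' : List E} (h : C.Step w w') : w.length = w'.length := by
  induction h with
  | head w h => rfl
  | cons e _ ih => simp [ih]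

/-- Words of edges modulo square swaps. -/
def Trace : Type _ := Quot C.Step

/-- The class of a word modulo square swaps. -/
def trace (w : List E) : C.Trace := Quot.mk _ w

theorem trace_eq_iff {w w' : List E} : C.trace w = C.trace w' ↔ Relation.ReflTransGen C.Step w w' := by
  constructor
  · intro h
    replace h : Relation.EqvGen C.Step w w' := Quot.eqvGen_exact h
    induction h with
    | rel _ _ h => exact .single h
    | refl => exact .refl
    | symm _ _ _ ih =>
      have : Std.Symm C.Step := ⟨fun _ _ h => Step.symm h⟩
      exact symm_of (Relation.ReflTransGen C.Step) ih
    | trans _ _ _ _ _ h₁ h₂ => exact h₁.trans h₂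
  · intro h
    induction h with
    | refl => rfl
    | tail _ h ih => exact ih.trans (Quot.sound h)

/-- Prepending an edge to a word, modulo square swaps. -/
def cons (e : E) : C.Trace → C.Trace :=
  Quot.map (List.cons e) fun _ _ h => Step.cons e h

/-- The number of letters. -/
def length : C.Trace → ℕ := Quot.lift List.length fun _ _ h => Step.length_eq h

@[simp] theorem cons_trace (e : E) (w : List E) : C.cons e (C.trace w) = C.trace (e :: w) := rfl

@[simp] theorem length_trace (w : List E) : C.length (C.trace w) = w.length := rfl

theorem exists_word (p : C.Trace) : ∃ w, C.trace w = p := Quot.exists_rep p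

@[simp] theorem length_cons (e : E) (p : C.Trace) : C.length (C.cons e p) = C.length p + 1 := by
  obtain ⟨w, rfl⟩ := C.exists_word p
  rfl

variable {C} in
theorem Sq.swap {a b a' b' : E} (h : C.Sq a b a' b') (p : C.Trace) :
    C.cons a (C.cons b' p) = C.cons b (C.cons a' p) := by
  obtain ⟨w, rfl⟩ := C.exists_word p
  exact Quot.sound (.head w h)

/-- Two different first letters of the same trace span a square, and can be brought to the front
together. The 3-cube condition is what makes the induction along a chain of swaps
close up. -/
theorem cons_eq_cons {a b : E} {p q : C.Trace} (h : C.cons a p = C.cons b q) :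
    (a = b ∧ p = q) ∨ ∃ a' b' r, C.Sq a b a' b' ∧ p = C.cons b' r ∧ q = C.cons a' r := by
  induction hn : C.length p using Nat.strong_induction_on generalizing a b p q with
  | _ n IH =>
  obtain ⟨u, rfl⟩ := C.exists_word p
  obtain ⟨v, rfl⟩ := C.exists_word q
  rw [cons_trace, cons_trace, trace_eq_iff] at h
  generalize hz : b :: v = z at h
  induction h generalizing b v with
  | refl =>
    cases hz
    exact Or.inl ⟨rfl, rfl⟩
  | tail hch hst ih =>
    cases hst with
    | cons e hst =>
      -- the last swap does not involve the first letter
      cases hz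
      rcases ih _ rfl with ⟨rfl, h2⟩ | ⟨a', b', r, h1, h2, h3⟩
      · exact Or.inl ⟨rfl, h2.trans (Quot.sound hst)⟩
      · exact Or.inr ⟨a', b', r, h1, h2, (Quot.sound hst.symm : C.trace v = _).trans h3⟩
    | @head b d b₁ c w hsq =>
      -- the last swap replaces the first letter by another one, across the square `hsq`; if `a` and
      -- the former first letter span a square `h1`, the two squares share an edge, and the shorter
      -- traces that follow this edge decide between a backtrack to `a` and the corner of a 3-cube
      cases hz
      rcases ih _ rfl with ⟨rfl, h2⟩ | ⟨a', b', r, h1, h2, h3⟩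
      · exact Or.inr ⟨b₁, c, C.trace w, hsq, h2, rfl⟩
      · have hl : C.length (C.trace w) < n := by
          have h4 := congrArg C.length h3
          have h5 := congrArg C.length h2
          simp only [length_trace, length_cons, List.length_cons] at h4 h5 hn
          simp only [length_trace]
          omega
        rcases IH _ hl (p := C.trace w) (q := r) (a := c) (b := a') h3 rfl with
          ⟨rfl, h5⟩ | ⟨c', a'', s, h5, h6, h7⟩
        · obtain ⟨h6, h7⟩ := C.uniq (C.rot (C.symm h1)) (C.rot hsq)
          refine Or.inl ⟨h7, ?_⟩
          have h8 : b' = b₁ := by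
            have := congrArg C.inv h6
            rwa [C.inv_inv, C.inv_inv] at this
          rw [h2, h8, ← h5]
          rfl
        · obtain ⟨x, y, z, k1, k2, k3⟩ := C.cube (C.rot hsq) h5 (C.rot (C.symm h1))
          have k4 := C.rot k2
          have k5 := C.rot k3
          rw [C.inv_inv] at k4 k5
          refine Or.inr ⟨z, y, C.cons (C.inv x) s, C.symm k1, ?_, ?_⟩
          · rw [h2, h7, k5.swap]
          · rw [← C.cons_trace, h6, k4.swap]

theorem cons_injective (e : E) : Function.Injective (C.cons e) := fun _ _ h => by
  rcases C.cons_eq_cons h with ⟨_, h⟩ | ⟨_, _, _, h, _⟩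
  · exact h
  · exact absurd rfl (C.ne h)

/-- The traces that have a representative with a backtrack `e e⁻¹`. -/
inductive Bad : C.Trace → Prop
  | head (e : E) (p : C.Trace) : Bad (C.cons e (C.cons (C.inv e) p))
  | cons (e : E) {p : C.Trace} : Bad p → Bad (C.cons e p)

/-- A reduced trace stays reduced when an edge is prepended, unless this edge visibly cancels
against a first letter. -/
theorem exists_eq_cons_inv {e : E} {p : C.Trace} (h : C.Bad (C.cons e p)) (hp : ¬ C.Bad p) :
    ∃ q, p = C.cons (C.inv e) q := by
  induction hn : C.length p using Nat.strong_induction_on generalizing e p with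
  | _ n IH =>
  generalize hz : C.cons e p = z at h
  cases h with
  | head f v =>
    rcases C.cons_eq_cons hz with ⟨rfl, h⟩ | ⟨e', f', r, h1, h2, h3⟩
    · exact ⟨v, h⟩
    · rcases C.cons_eq_cons h3 with ⟨rfl, h4⟩ | ⟨f₂, e₂, s, h4, h5, h6⟩
      · exact absurd rfl (C.ne (C.rot (C.symm h1)))
      · obtain ⟨h7, -⟩ := C.uniq h4 (C.rot (C.symm h1))
        refine absurd ?_ hp
        rw [h2, h6, h7]
        exact .head _ _
  | @cons l q hq =>
    rcases C.cons_eq_cons hz with ⟨rfl, h⟩ | ⟨e', l', r, h1, h2, h3⟩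
    · exact absurd (h ▸ hq) hp
    · have hr : ¬ C.Bad r := fun hr => hp (h2 ▸ .cons _ hr)
      have hl : C.length r < n := by rw [← hn, h2, length_cons]; omega
      obtain ⟨s, rfl⟩ := IH _ hl (h3 ▸ hq) hr rfl
      exact ⟨C.cons l s, by rw [h2, (C.rot h1).swap]⟩

open Classical in
/-- The action of an edge on traces: cancel the edge against a first letter, if that is possible,
and prepend it otherwise. -/
noncomputable def act (e : E) (p : C.Trace) : C.Trace :=
  if h : ∃ q, p = C.cons (C.inv e) q then h.choose else C.cons e p

theorem act_cons_inv (e : E) (p : C.Trace) : C.act e (C.cons (C.inv e) p) = p := by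
  have h : ∃ q, C.cons (C.inv e) p = C.cons (C.inv e) q := ⟨p, rfl⟩
  rw [act, dif_pos h]
  exact (C.cons_injective _ h.choose_spec).symm

theorem act_of_not {e : E} {p : C.Trace} (h : ¬ ∃ q, p = C.cons (C.inv e) q) :
    C.act e p = C.cons e p := dif_neg h

theorem act_of_not_bad {e : E} {p : C.Trace} (h : ¬ C.Bad (C.cons e p)) :
    C.act e p = C.cons e p := by
  refine C.act_of_not ?_
  rintro ⟨q, rfl⟩
  exact h (.head _ _)

theorem not_bad_act {e : E} {p : C.Trace} (hp : ¬ C.Bad p) : ¬ C.Bad (C.act e p) := by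
  by_cases h : ∃ q, p = C.cons (C.inv e) q
  · obtain ⟨q, rfl⟩ := h
    rw [act_cons_inv]
    exact fun h => hp (.cons _ h)
  · rw [C.act_of_not h]
    exact fun hb => h (C.exists_eq_cons_inv hb hp)

theorem act_inv_act {e : E} {p : C.Trace} (hp : ¬ C.Bad p) : C.act (C.inv e) (C.act e p) = p := by
  by_cases h : ∃ q, p = C.cons (C.inv e) q
  · obtain ⟨q, rfl⟩ := h
    rw [act_cons_inv]
    refine C.act_of_not ?_
    rintro ⟨r, rfl⟩
    exact hp (.head _ _)
  · rw [C.act_of_not h]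
    have := C.act_cons_inv (C.inv e) p
    rwa [C.inv_inv] at this

variable {C} in
/-- The two ways around a square act in the same way on reduced traces. -/
theorem Sq.act_comm {a b a' b' : E} (h : C.Sq a b a' b') {p : C.Trace} (hp : ¬ C.Bad p) :
    C.act a (C.act b' p) = C.act b (C.act a' p) := by
  have key : ∀ {a b a' b' : E}, C.Sq a b a' b' → (∃ q, p = C.cons (C.inv b') q) →
      C.act a (C.act b' p) = C.act b (C.act a' p) := by
    intro a b a' b' h hb
    obtain ⟨q, rfl⟩ := hb
    rw [act_cons_inv]
    by_cases ha : ∃ r, C.cons (C.inv b') q = C.cons (C.inv a') r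
    · obtain ⟨r, hr⟩ := ha
      rw [hr, act_cons_inv]
      have hc := h.opp
      rcases C.cons_eq_cons hr with ⟨h1, -⟩ | ⟨x, y, s, h1, h2, h3⟩
      · exact absurd h1 (C.ne hc)
      · obtain ⟨h4, h5⟩ := C.uniq hc h1
        rw [h2, h3, ← h4, ← h5, act_cons_inv, act_cons_inv]
    · rw [C.act_of_not ha]
      have hq : ¬ ∃ r, q = C.cons (C.inv a) r := by
        rintro ⟨r, rfl⟩
        exact ha ⟨C.cons (C.inv b) r, h.opp.swap r⟩
      rw [C.act_of_not hq, ← (C.rot (C.symm h)).swap q, act_cons_inv]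
  by_cases hb : ∃ q, p = C.cons (C.inv b') q
  · exact key h hb
  · by_cases ha : ∃ q, p = C.cons (C.inv a') q
    · exact (key (C.symm h) ha).symm
    · rw [C.act_of_not ha, C.act_of_not hb]
      have h1 : ∀ {a b a' b' : E}, C.Sq a b a' b' → (¬ ∃ q, p = C.cons (C.inv a') q) →
          ¬ ∃ r, C.cons b' p = C.cons (C.inv a) r := by
        rintro a b a' b' h ha ⟨r, hr⟩
        rcases C.cons_eq_cons hr with ⟨h1, -⟩ | ⟨x, y, s, h1, h2, h3⟩
        · exact C.ne (C.rot h) h1.symm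
        · obtain ⟨h4, h5⟩ := C.uniq h1 (C.symm (C.rot h))
          exact ha ⟨s, by rw [h2, h5]⟩
      rw [C.act_of_not (h1 h ha), C.act_of_not (h1 (C.symm h) hb), h.swap]

/-- The permutation of the set of reduced traces given by an edge. -/
noncomputable def actPerm (e : E) : Equiv.Perm {p : C.Trace // ¬ C.Bad p} where
  toFun p := ⟨C.act e p.1, C.not_bad_act p.2⟩
  invFun p := ⟨C.act (C.inv e) p.1, C.not_bad_act p.2⟩
  left_inv p := Subtype.ext (C.act_inv_act p.2)
  right_inv p := Subtype.ext (by simpa [C.inv_inv] using C.act_inv_act (e := C.inv e) p.2)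

theorem bad_trace_iff {w : List E} :
    C.Bad (C.trace w) ↔ ∃ u e v, C.trace w = C.trace (u ++ e :: C.inv e :: v) := by
  constructor
  · intro h
    generalize C.trace w = p at h
    induction h with
    | head e p =>
      obtain ⟨v, rfl⟩ := C.exists_word p
      exact ⟨[], e, v, rfl⟩
    | cons e _ ih =>
      obtain ⟨u, f, v, rfl⟩ := ih
      exact ⟨e :: u, f, v, rfl⟩
  · rintro ⟨u, e, v, h⟩
    rw [h]
    clear h
    induction u with
    | nil => exact .head e (C.trace v)
    | cons f u ih => exact .cons f ih

theorem not_bad_nil : ¬ C.Bad (C.trace []) := by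
  rw [bad_trace_iff]
  rintro ⟨u, e, v, h⟩
  have := congrArg C.length h
  simp at this

variable {C} in
theorem Step.append_right {w w' : List E} (h : C.Step w w') (v : List E) :
    C.Step (w ++ v) (w' ++ v) := by
  induction h with
  | head w h => exact .head _ h
  | cons e _ ih => exact .cons e ih

theorem trace_append_congr {w w' : List E} (h : C.trace w = C.trace w') (v : List E) :
    C.trace (w ++ v) = C.trace (w' ++ v) := by
  rw [trace_eq_iff] at h
  induction h with
  | refl => rfl
  | tail _ h ih => exact ih.trans (Quot.sound (h.append_right v))

theorem bad_append_right {w : List E} (v : List E) (h : C.Bad (C.trace w)) :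
    C.Bad (C.trace (w ++ v)) := by
  rw [bad_trace_iff] at h ⊢
  obtain ⟨u, e, x, h⟩ := h
  exact ⟨u, e, x ++ v, by simpa using C.trace_append_congr h v⟩

/-- Every word can be brought to a reduced word by square swaps and deletions of backtracks;
stated as an induction principle for properties that survive these moves. -/
theorem exists_reduced {P : List E → Prop} (hs : ∀ w w', C.Step w w' → P w → P w')
    (hd : ∀ u e v, P (u ++ e :: C.inv e :: v) → P (u ++ v)) {w : List E} (hw : P w) :
    ∃ w', P w' ∧ ¬ C.Bad (C.trace w') ∧ w'.length ≤ w.length ∧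
      (C.Bad (C.trace w) → w'.length < w.length) := by
  induction hn : w.length using Nat.strong_induction_on generalizing w with
  | _ n IH =>
  by_cases hb : C.Bad (C.trace w)
  · obtain ⟨u, e, v, h⟩ := C.bad_trace_iff.1 hb
    have hl := congrArg C.length h
    have hP : ∀ {w'}, Relation.ReflTransGen C.Step w w' → P w' := fun h => by
      induction h with
      | refl => exact hw
      | tail _ h ih => exact hs _ _ h ih
    have h' := hP ((C.trace_eq_iff).1 h)
    simp only [length_trace, List.length_append, List.length_cons] at hl
    obtain ⟨w', h1, h2, h3, -⟩ := IH (u ++ v).length (by simp; omega) (hd _ _ _ h') rfl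
    rw [List.length_append] at h3
    exact ⟨w', h1, h2, by omega, fun _ => by omega⟩
  · exact ⟨w, hw, hb, hn.le, fun h => absurd h hb⟩

/-! ### Edge paths -/

/-- `w` is the list of edges of a path from `x` to `y`. -/
def IsPath : V → List E → V → Prop
  | x, [], y => x = y
  | x, e :: w, y => C.src e = x ∧ IsPath (C.tgt e) w y

variable {C}

theorem IsPath.append {x y z : V} {u v : List E} (h : C.IsPath x u y) (h' : C.IsPath y v z) :
    C.IsPath x (u ++ v) z := by
  induction u generalizing x with
  | nil => cases h; exact h'
  | cons e u ih => exact ⟨h.1, ih h.2⟩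

theorem isPath_append {x z : V} {u v : List E} :
    C.IsPath x (u ++ v) z ↔ ∃ y, C.IsPath x u y ∧ C.IsPath y v z := by
  refine ⟨fun h => ?_, fun ⟨y, h, h'⟩ => h.append h'⟩
  induction u generalizing x with
  | nil => exact ⟨x, rfl, h⟩
  | cons e u ih =>
    obtain ⟨y, h1, h2⟩ := ih h.2
    exact ⟨y, ⟨h.1, h1⟩, h2⟩

theorem IsPath.step {w w' : List E} (h : C.Step w w') {x y : V} (hw : C.IsPath x w y) :
    C.IsPath x w' y := by
  induction h generalizing x with
  | head w h =>
    obtain ⟨h1, h2, h3⟩ := hw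
    exact ⟨(C.src_eq h).symm.trans h1, (C.tgt_eq (C.symm h)).symm, (C.tgt_eq' h) ▸ h3⟩
  | cons e _ ih => exact ⟨hw.1, ih hw.2⟩

theorem IsPath.delete {u v : List E} {e : E} {x y : V}
    (hw : C.IsPath x (u ++ e :: C.inv e :: v) y) : C.IsPath x (u ++ v) y := by
  obtain ⟨z, h1, h2, -, h4⟩ := isPath_append.1 hw
  rw [tgt_inv] at h4
  exact h1.append (h2 ▸ h4)

variable (C) in
/-- A flag square complex is `SimplyConn` if it is connected and every flat cocycle on its edges
with values in a group is the coboundary of a function on the vertices. This replaces the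
vanishing of the fundamental group; the groups are allowed to be non-abelian. -/
structure SimplyConn : Prop where
  conn : ∀ x y, ∃ w, C.IsPath x w y
  hol : ∀ (Γ : Type w) [Group Γ] (φ : E → Γ), (∀ e, φ (C.inv e) = (φ e)⁻¹) →
    (∀ a b a' b', C.Sq a b a' b' → φ a * φ b' = φ b * φ a') →
    ∃ ψ : V → Γ, ∀ e, ψ (C.tgt e) = ψ (C.src e) * φ e

/-- Reduced paths with the same ends differ by square swaps: the cocycle `actPerm` has no holonomy,
and a reduced word `w` sends the empty trace to the trace of `w`. -/
theorem SimplyConn.trace_eq (hC : C.SimplyConn) {x y : V} {w w' : List E} (hw : C.IsPath x w y)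
    (hw' : C.IsPath x w' y) (hr : ¬ C.Bad (C.trace w)) (hr' : ¬ C.Bad (C.trace w')) :
    C.trace w = C.trace w' := by
  obtain ⟨ψ, hψ⟩ := hC.hol _ C.actPerm
    (fun e => by ext p; rfl)
    (fun a b a' b' h => by ext p; exact h.act_comm p.2)
  have key : ∀ (w : List E) (x : V), C.IsPath x w y → ψ y = ψ x * (w.map C.actPerm).prod := by
    intro w
    induction w with
    | nil => intro x h; cases h; simp
    | cons e w ih =>
      intro x h
      obtain ⟨rfl, h⟩ := h
      rw [ih _ h, hψ, List.map_cons, List.prod_cons, mul_assoc]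
  have key2 : ∀ w : List E, ¬ C.Bad (C.trace w) →
      ((w.map C.actPerm).prod ⟨C.trace [], C.not_bad_nil⟩).1 = C.trace w := by
    intro w
    induction w with
    | nil => intro _; rfl
    | cons e w ih =>
      intro h
      have h' : ¬ C.Bad (C.trace w) := fun h' => h (.cons e h')
      rw [List.map_cons, List.prod_cons, Equiv.Perm.mul_apply]
      change C.act e _ = _
      rw [ih h']
      exact C.act_of_not_bad (p := C.trace w) h
  rw [← key2 w hr, ← key2 w' hr', mul_left_cancel ((key w x hw).symm.trans (key w' x hw'))]

/-! ### Walls -/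

variable (C) in
/-- `Slide x w y`: the edge `x`, which issues from the initial vertex of the path `w`, can be moved
along `w` through a ladder of squares, and arrives as `y` at the end of `w`. -/
inductive Slide : E → List E → E → Prop
  | nil (x : E) : Slide x [] x
  | cons {x b x₁ b₁ y : E} {w : List E} : C.Sq x b x₁ b₁ → Slide x₁ w y → Slide x (b :: w) y

theorem Slide.append {x y z : E} {u v : List E} (h : C.Slide x u y) (h' : C.Slide y v z) :
    C.Slide x (u ++ v) z := by
  induction h with
  | nil => exact h'
  | cons h1 _ ih => exact .cons h1 (ih h')

theorem slide_append {x z : E} {u v : List E} :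
    C.Slide x (u ++ v) z ↔ ∃ y, C.Slide x u y ∧ C.Slide y v z := by
  refine ⟨fun h => ?_, fun ⟨y, h, h'⟩ => h.append h'⟩
  induction u generalizing x with
  | nil => exact ⟨x, .nil x, h⟩
  | cons e u ih =>
    cases h with
    | cons h1 h2 =>
      obtain ⟨y, h3, h4⟩ := ih h2
      exact ⟨y, .cons h1 h3, h4⟩

/-- A ladder along two sides of a square can be pushed across the square, by the 3-cube
condition. -/
theorem Slide.step {w w' : List E} (h : C.Step w w') {x y : E} (hw : C.Slide x w y) :
    C.Slide x w' y := by
  induction h generalizing x with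
  | head w h =>
    cases hw with
    | cons h1 hw =>
    cases hw with
    | cons h2 hw =>
    obtain ⟨p, q, r, k1, k2, -⟩ := C.cube (C.rot h) (C.symm h2) (C.rot (C.symm h1))
    have k3 := C.rot k2
    rw [C.inv_inv] at k3
    exact .cons (C.symm k1) (.cons (C.symm k3) hw)
  | cons e _ ih =>
    cases hw with
    | cons h1 hw => exact .cons h1 (ih hw)

theorem Slide.of_trace_eq {w w' : List E} {x y : E} (hw : C.Slide x w y)
    (h : C.trace w = C.trace w') : C.Slide x w' y := by
  rw [trace_eq_iff] at h
  induction h with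
  | refl => exact hw
  | tail _ h ih => exact ih.step h

theorem Slide.delete {u v : List E} {e : E} {x y : E}
    (hw : C.Slide x (u ++ e :: C.inv e :: v) y) : C.Slide x (u ++ v) y := by
  obtain ⟨z, h1, h2⟩ := slide_append.1 hw
  refine h1.append ?_
  cases h2 with
  | cons h2 h3 =>
  cases h3 with
  | cons h3 h4 =>
  rw [(C.uniq h3 (C.symm (C.rot (C.symm h2)))).1] at h4
  exact h4

/-- The reverse of an edge that slides along `w` can be moved, as a letter, from the front of `w` to
the back, where `w` is replaced with the opposite side of the ladder. -/
theorem Slide.exists_trace_eq {x y : E} {w : List E} (h : C.Slide x w y) :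
    ∃ w', C.trace (C.inv x :: w) = C.trace (w' ++ [C.inv y]) := by
  induction h with
  | nil x => exact ⟨[], rfl⟩
  | @cons x b x₁ b₁ y w h1 h2 ih =>
    obtain ⟨w', h⟩ := ih
    refine ⟨b₁ :: w', ?_⟩
    have := (C.rot h1).swap (C.trace w)
    exact this.trans (congrArg (C.cons b₁) h)

variable (C) in
/-- Elementary parallelism: an edge is parallel to its reverse and to the opposite edges
in squares. -/
inductive Parallel : E → E → Prop
  | inv (e : E) : Parallel e (C.inv e)
  | sq {e b e' b' : E} : C.Sq e b e' b' → Parallel e e'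

variable (C) in
/-- The walls (hyperplanes): the parallelism classes of edges. -/
def Wall : Type w := Quot C.Parallel

variable (C) in
/-- The wall that an edge crosses. -/
def wall (e : E) : C.Wall := Quot.mk _ e

@[simp] theorem wall_inv (e : E) : C.wall (C.inv e) = C.wall e := (Quot.sound (.inv e)).symm

theorem Sq.wall_eq {a b a' b' : E} (h : C.Sq a b a' b') : C.wall a = C.wall a' :=
  Quot.sound (.sq h)

theorem exists_slide_of_wall_eq {e f : E} (h : C.wall e = C.wall f) :
    ∃ g w, (g = f ∨ g = C.inv f) ∧ C.IsPath (C.src e) w (C.src g) ∧ C.Slide e w g := by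
  let P : E → Prop := fun f =>
    ∃ g w, (g = f ∨ g = C.inv f) ∧ C.IsPath (C.src e) w (C.src g) ∧ C.Slide e w g
  have hsq : ∀ {f f' b b' : E}, C.Sq f b f' b' → P f → P f' := by
    rintro f f' b b' h ⟨g, w, rfl | rfl, h1, h2⟩
    · exact ⟨f', w ++ [b], Or.inl rfl, h1.append ⟨(C.src_eq h).symm, C.tgt_eq (C.symm h)⟩,
        h2.append (.cons h (.nil _))⟩
    · exact ⟨C.inv f', w ++ [b'], Or.inr rfl,
        h1.append ⟨(C.src_eq (C.rot h)).symm, C.tgt_eq (C.symm (C.rot h))⟩,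
        h2.append (.cons (C.rot h) (.nil _))⟩
  have key : ∀ {f f' : E}, Relation.EqvGen C.Parallel f f' → (P f ↔ P f') := by
    intro f f' h
    induction h with
    | rel f f' h =>
      cases h with
      | inv => simp only [P, C.inv_inv, or_comm]
      | sq h => exact ⟨hsq h, hsq h.flip⟩
    | refl => exact Iff.rfl
    | symm _ _ _ ih => exact ih.symm
    | trans _ _ _ _ _ h₁ h₂ => exact h₁.trans h₂
  exact (key (Quot.eqvGen_exact h)).1 ⟨e, [], Or.inl rfl, rfl, .nil e⟩

/-- A reduced path crosses every wall at most once. If it crossed a wall at `e` and again at `f`,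
a ladder of squares from `e` to `f` would have a side with the same ends as the part of the path
between `e` and `f`; so `e` could be moved along this part, and would cancel against `f` or span
a degenerate square with it. -/
theorem SimplyConn.nodup (hC : C.SimplyConn) {x y : V} {w : List E} (hw : C.IsPath x w y)
    (hr : ¬ C.Bad (C.trace w)) : (w.map C.wall).Nodup := by
  induction w generalizing x with
  | nil => simp
  | cons e w ih =>
  rw [List.map_cons, List.nodup_cons]
  refine ⟨fun hmem => ?_, ih hw.2 fun h => hr (.cons e h)⟩
  obtain ⟨f, hf, hef⟩ := List.mem_map.1 hmem
  obtain ⟨u, v, rfl⟩ := List.append_of_mem hf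
  obtain ⟨g, l, hg, hl, hs⟩ := exists_slide_of_wall_eq (e := C.inv e) (f := f) (by rw [wall_inv, hef])
  have hsw := hw.2
  rw [C.src_inv] at hl
  -- `e` slides along every reduced path with the ends of the ladder
  have slide : ∀ z, C.IsPath (C.tgt e) z (C.src g) → ¬ C.Bad (C.trace z) →
      C.Slide (C.inv e) z g := by
    intro z hz hzr
    obtain ⟨l', ⟨h1, h2⟩, h3, -⟩ := C.exists_reduced
      (P := fun l => C.IsPath (C.tgt e) l (C.src g) ∧ C.Slide (C.inv e) l g)
      (fun _ _ h h' => ⟨h'.1.step h, h'.2.step h⟩) (fun _ _ _ h' => ⟨h'.1.delete, h'.2.delete⟩)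
      ⟨hl, hs⟩
    exact h2.of_trace_eq (hC.trace_eq h1 hz h3 hzr)
  obtain ⟨m, hu, rfl, hv⟩ := isPath_append.1 hsw
  have hrw : ¬ C.Bad (C.trace (u ++ f :: v)) := fun h => hr (.cons e h)
  rcases hg with rfl | rfl
  · -- `e` is carried to the reverse of `f`, and cancels against `f`
    have h1 := slide u hu fun h => hrw (C.bad_append_right _ h)
    obtain ⟨w', h2⟩ := h1.exists_trace_eq
    rw [C.inv_inv] at h2
    have h3 := C.trace_append_congr h2 (g :: v)
    apply hr
    rw [List.cons_append] at h3
    rw [h3, C.bad_trace_iff]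
    exact ⟨w', C.inv g, v, by simp [C.inv_inv]⟩
  · -- the last square of the ladder has `f` and the reverse of `f` as consecutive sides, so two equal
    -- edges issue from one of its corners
    have h1 := slide (u ++ [f]) (hu.append ⟨rfl, (C.src_inv f).symm⟩)
      fun h => hrw (by simpa using C.bad_append_right v h)
    obtain ⟨z, -, h2⟩ := slide_append.1 h1
    cases h2 with
    | cons h2 h3 =>
      cases h3
      exact C.ne (C.rot (C.symm h2)) rfl

/-- Counting modulo two the crossings of each wall is a flat cocycle, so every wall has
two sides. -/
theorem SimplyConn.exists_side (hC : C.SimplyConn) : ∃ side : V → C.Wall → ZMod 2,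
    ∀ e, (∀ h, h ≠ C.wall e → side (C.tgt e) h = side (C.src e) h) ∧
      side (C.tgt e) (C.wall e) ≠ side (C.src e) (C.wall e) := by
  classical
  obtain ⟨ψ, hψ⟩ := hC.hol (Multiplicative (C.Wall → ZMod 2))
    (fun e => Multiplicative.ofAdd (Pi.single (C.wall e) 1))
    (fun e => by
      rw [wall_inv, ← ofAdd_neg]
      congr 1
      ext h
      exact (CharTwo.neg_eq _).symm)
    (fun a b a' b' h => by rw [h.wall_eq, (C.symm h).wall_eq, mul_comm])
  refine ⟨fun v h => Multiplicative.toAdd (ψ v) h, fun e => ⟨fun h hh => ?_, ?_⟩⟩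
  · simp [hψ, hh]
  · simp [hψ]

/-- The side of the wall `h` on which a vertex lies, as a label in `ZMod 2`. -/
noncomputable def SimplyConn.side (hC : C.SimplyConn) : V → C.Wall → ZMod 2 :=
  hC.exists_side.choose

/-- The walls that separate two vertices. -/
def SimplyConn.sep (hC : C.SimplyConn) (x y : V) : Set C.Wall :=
  {h | hC.side x h ≠ hC.side y h}

/-- The halfspace of the wall `h` that contains `x`. -/
def SimplyConn.half (hC : C.SimplyConn) (x : V) (h : C.Wall) : Set V :=
  {z | hC.side z h = hC.side x h}

namespace SimplyConn

variable (hC : C.SimplyConn)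

theorem side_tgt {e : E} {h : C.Wall} (hh : h ≠ C.wall e) :
    hC.side (C.tgt e) h = hC.side (C.src e) h :=
  (hC.exists_side.choose_spec e).1 h hh

theorem side_tgt_ne (e : E) :
    hC.side (C.tgt e) (C.wall e) ≠ hC.side (C.src e) (C.wall e) :=
  (hC.exists_side.choose_spec e).2

theorem mem_sep {x y : V} {h : C.Wall} : h ∈ hC.sep x y ↔ hC.side x h ≠ hC.side y h := Iff.rfl

theorem _root_.zmod_two_eq {a b c : ZMod 2} (h : a ≠ b) (h' : c ≠ b) : a = c := by
  revert a b c
  decide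

theorem sep_comm (x y : V) : hC.sep x y = hC.sep y x := by
  ext h
  exact ne_comm

theorem mem_sep_tgt {e : E} {x : V} {h : C.Wall} :
    h ∈ hC.sep (C.tgt e) x ↔ (h ≠ C.wall e ∧ h ∈ hC.sep (C.src e) x) ∨
      (h = C.wall e ∧ h ∉ hC.sep (C.src e) x) := by
  simp only [mem_sep]
  by_cases hh : h = C.wall e
  · subst hh
    have := hC.side_tgt_ne e
    simp only [ne_eq, not_true_eq_false, false_and, true_and, false_or, not_not]
    exact ⟨fun h => zmod_two_eq this.symm (Ne.symm h), fun h => h ▸ this⟩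
  · simp [hh, hC.side_tgt hh]

theorem sep_subset {x y : V} {w : List E} (hw : C.IsPath x w y) {h : C.Wall}
    (hh : h ∈ hC.sep x y) : h ∈ w.map C.wall := by
  induction w generalizing x with
  | nil => cases hw; exact absurd rfl hh
  | cons e w ih =>
    obtain ⟨rfl, hw⟩ := hw
    rw [List.map_cons, List.mem_cons]
    by_cases he : h = C.wall e
    · exact Or.inl he
    · exact Or.inr (ih hw (hC.mem_sep_tgt.2 (Or.inl ⟨he, hh⟩)))

theorem mem_sep_of_nodup {x y : V} {w : List E} (hw : C.IsPath x w y)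
    (hn : (w.map C.wall).Nodup) {h : C.Wall} (hh : h ∈ w.map C.wall) : h ∈ hC.sep x y := by
  induction w generalizing x with
  | nil => simp at hh
  | cons e w ih =>
    obtain ⟨rfl, hw⟩ := hw
    rw [List.map_cons, List.nodup_cons] at hn
    rw [List.map_cons, List.mem_cons] at hh
    by_cases he : h = C.wall e
    · by_contra hc
      exact hn.1 (he ▸ hC.sep_subset hw (hC.mem_sep_tgt.2 (Or.inr ⟨he, hc⟩)))
    · exact ((hC.mem_sep_tgt.1 (ih hw hn.2 (hh.resolve_left he))).resolve_right
        fun h => he h.1).2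

/-- A reduced path crosses exactly the walls that separate its ends. -/
theorem sep_eq {x y : V} {w : List E} (hw : C.IsPath x w y) (hr : ¬ C.Bad (C.trace w)) :
    hC.sep x y = {h | h ∈ w.map C.wall} :=
  Set.ext fun _ => ⟨hC.sep_subset hw, hC.mem_sep_of_nodup hw (hC.nodup hw hr)⟩

theorem ncard_sep {x y : V} {w : List E} (hw : C.IsPath x w y) (hr : ¬ C.Bad (C.trace w)) :
    (hC.sep x y).ncard = w.length := by
  classical
  rw [hC.sep_eq hw hr, ← List.coe_toFinset, Set.ncard_coe_finset,
    List.toFinset_card_of_nodup (hC.nodup hw hr), List.length_map]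

theorem exists_reduced_path {x y : V} {w : List E} (hw : C.IsPath x w y) :
    ∃ w', C.IsPath x w' y ∧ ¬ C.Bad (C.trace w') ∧ w'.length ≤ w.length ∧
      (C.Bad (C.trace w) → w'.length < w.length) :=
  C.exists_reduced (P := fun w => C.IsPath x w y) (fun _ _ h hw => hw.step h)
    (fun _ _ _ hw => hw.delete) hw

theorem exists_geodesic (x y : V) :
    ∃ w, C.IsPath x w y ∧ ¬ C.Bad (C.trace w) ∧ w.length = (hC.sep x y).ncard := by
  obtain ⟨w, hw⟩ := hC.conn x y
  obtain ⟨w', h1, h2, -⟩ := exists_reduced_path hw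
  exact ⟨w', h1, h2, (hC.ncard_sep h1 h2).symm⟩

theorem finite_sep (x y : V) : (hC.sep x y).Finite := by
  obtain ⟨w, h1, h2, -⟩ := hC.exists_geodesic x y
  rw [hC.sep_eq h1 h2]
  exact List.finite_toSet _

/-- A path that is not longer than the number of walls between its ends is reduced. -/
theorem not_bad_of_length {x y : V} {w : List E} (hw : C.IsPath x w y)
    (h : w.length ≤ (hC.sep x y).ncard) : ¬ C.Bad (C.trace w) := fun hb => by
  obtain ⟨w', h1, h2, -, h3⟩ := exists_reduced_path hw
  have := hC.ncard_sep h1 h2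
  have := h3 hb
  omega

theorem sep_tgt {e : E} {x : V} (h : C.wall e ∈ hC.sep (C.src e) x) :
    hC.sep (C.tgt e) x = hC.sep (C.src e) x \ {C.wall e} := by
  ext k
  rw [mem_sep_tgt, Set.mem_sdiff, Set.mem_singleton_iff]
  constructor
  · rintro (⟨h1, h2⟩ | ⟨rfl, h2⟩)
    · exact ⟨h2, h1⟩
    · exact absurd h h2
  · exact fun h => Or.inl ⟨h.2, h.1⟩

theorem ncard_sep_tgt {e : E} {x : V} (h : C.wall e ∈ hC.sep (C.src e) x) :
    (hC.sep (C.tgt e) x).ncard + 1 = (hC.sep (C.src e) x).ncard := by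
  rw [hC.sep_tgt h, Set.ncard_sdiff_singleton_add_one h (hC.finite_sep _ _)]

theorem exists_geodesic_cons {e : E} {z : V} (h : C.wall e ∈ hC.sep (C.src e) z) :
    ∃ w, C.IsPath (C.src e) (e :: w) z ∧ ¬ C.Bad (C.trace (e :: w)) := by
  obtain ⟨w, h1, -, h3⟩ := hC.exists_geodesic (C.tgt e) z
  have h4 : C.IsPath (C.src e) (e :: w) z := ⟨rfl, h1⟩
  refine ⟨w, h4, hC.not_bad_of_length h4 ?_⟩
  rw [← hC.ncard_sep_tgt h, List.length_cons, h3]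

/-- Two edges at a vertex span a square as soon as their walls both separate this vertex from
some other vertex. -/
theorem exists_sq {a b : E} (hab : C.src a = C.src b) (hne : C.wall a ≠ C.wall b) {z : V}
    (ha : C.wall a ∈ hC.sep (C.src a) z) (hb : C.wall b ∈ hC.sep (C.src b) z) :
    ∃ a' b', C.Sq a b a' b' := by
  obtain ⟨u, h1, h2⟩ := hC.exists_geodesic_cons ha
  obtain ⟨v, h3, h4⟩ := hC.exists_geodesic_cons hb
  rw [← hab] at h3
  rcases C.cons_eq_cons (p := C.trace u) (q := C.trace v) (hC.trace_eq h1 h3 h2 h4) with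
    ⟨rfl, -⟩ | ⟨a', b', -, h, -⟩
  · exact absurd rfl hne
  · exact ⟨a', b', h⟩

theorem half_tgt {e : E} {h : C.Wall} (hh : h ≠ C.wall e) :
    hC.half (C.tgt e) h = hC.half (C.src e) h := by
  rw [half, half, hC.side_tgt hh]

theorem mem_half {x y : V} {h : C.Wall} : y ∈ hC.half x h ↔ h ∉ hC.sep x y := by
  rw [mem_sep, not_not]
  exact eq_comm

theorem mem_sep_of_half_subset {x x₀ : V} {h k : C.Wall} (hh : h ∈ hC.sep x x₀)
    (hk : hC.half x k ⊆ hC.half x h) : k ∈ hC.sep x x₀ := by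
  by_contra hc
  exact hC.mem_half.1 (hk (hC.mem_half.2 hc)) hh

/-- Distinct walls have distinct halfspaces. -/
theorem half_injective {x y : V} {h k : C.Wall} (hh : hC.half x h = hC.half y k) : h = k := by
  by_contra hne
  obtain ⟨e, rfl⟩ : ∃ e, C.wall e = k := Quot.exists_rep k
  have h1 : hC.side (C.tgt e) h = hC.side (C.src e) h := hC.side_tgt hne
  have h2 := hC.side_tgt_ne e
  have h3 : ∀ z, hC.side z h = hC.side x h ↔ hC.side z (C.wall e) = hC.side y (C.wall e) :=
    fun z => Set.ext_iff.1 hh z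
  by_cases h4 : hC.side (C.tgt e) h = hC.side x h
  · exact h2 (((h3 _).1 h4).trans ((h3 _).1 (h1 ▸ h4)).symm)
  · exact h2 (zmod_two_eq (fun h => h4 ((h3 _).2 h)) (fun h => h4 (h1.trans ((h3 _).2 h))))

/-- Below every halfspace that contains `x` and not `x₀` there is one bounded by the wall of an
edge at `x`. -/
theorem exists_edge_half_subset {x x₀ : V} {h : C.Wall} (hh : h ∈ hC.sep x x₀) :
    ∃ e, C.src e = x ∧ hC.half x (C.wall e) ⊆ hC.half x h := by
  obtain ⟨w, hw, hr, -⟩ := hC.exists_geodesic x x₀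
  induction w generalizing x with
  | nil => cases hw; exact absurd rfl hh
  | cons e w ih =>
  obtain ⟨rfl, hw'⟩ := id hw
  have hek : C.wall e ∈ hC.sep (C.src e) x₀ := by
    rw [hC.sep_eq hw hr]
    simp
  by_cases he : h = C.wall e
  · exact ⟨e, rfl, he ▸ subset_rfl⟩
  have hy : h ∈ hC.sep (C.tgt e) x₀ := hC.mem_sep_tgt.2 (Or.inl ⟨he, hh⟩)
  obtain ⟨b, hb, hbh⟩ := ih hy hw' fun h => hr (.cons e h)
  have hbx : C.wall b ∈ hC.sep (C.tgt e) x₀ := hC.mem_sep_of_half_subset hy hbh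
  have hbe : C.wall b ≠ C.wall e := by
    intro hbe
    rw [hC.sep_tgt hek] at hbx
    exact hbx.2 hbe
  rw [hC.half_tgt he, hC.half_tgt hbe] at hbh
  by_cases hsub : hC.half (C.src e) (C.wall e) ⊆ hC.half (C.src e) (C.wall b)
  · exact ⟨e, rfl, hsub.trans hbh⟩
  · -- seen from the end of `e`, the vertex `z` lies beyond the walls of both `e` and `b`, so these
    -- edges span a square, whose side opposite to `b` issues from the other end of `e`
    obtain ⟨z, hz, hz'⟩ := Set.not_subset.1 hsub
    rw [mem_half] at hz hz'
    rw [not_not] at hz'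
    have h1 : C.wall e ∈ hC.sep (C.tgt e) z := hC.mem_sep_tgt.2 (Or.inr ⟨rfl, hz⟩)
    have h2 : C.wall b ∈ hC.sep (C.tgt e) z := hC.mem_sep_tgt.2 (Or.inl ⟨hbe, hz'⟩)
    obtain ⟨a', b', hsq⟩ := hC.exists_sq (a := C.inv e) (b := b) (z := z)
      ((C.src_inv e).trans hb.symm) (by rw [wall_inv]; exact hbe.symm)
      (by rwa [wall_inv, C.src_inv]) (by rwa [hb])
    refine ⟨b', ?_, ?_⟩
    · rw [← C.tgt_eq hsq, C.tgt_inv]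
    · rwa [← (C.symm hsq).wall_eq]

/-- Pairwise incomparable halfspaces which contain `x` and not `x₀` are at most as many as the edges
at some vertex: as long as not all their walls pass through edges at `x`, the vertex `x` can be
moved towards `x₀` across a wall that is not among them. -/
theorem card_antichain_le {N : ℕ} (hfin : ∀ v, {e | C.src e = v}.Finite)
    (hN : ∀ v, {e | C.src e = v}.ncard ≤ N) {x x₀ : V} (A : Finset C.Wall)
    (hA : ∀ h ∈ A, h ∈ hC.sep x x₀)
    (hanti : ∀ h ∈ A, ∀ k ∈ A, hC.half x h ⊆ hC.half x k → h = k) : A.card ≤ N := by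
  induction hn : (hC.sep x x₀).ncard generalizing x with
  | zero =>
    rw [Set.ncard_eq_zero (hC.finite_sep _ _)] at hn
    have : A = ∅ := Finset.eq_empty_of_forall_notMem fun h hh => by simpa [hn] using hA h hh
    simp [this]
  | succ n ih =>
  by_cases hall : ∀ h ∈ A, ∃ e, C.src e = x ∧ C.wall e = h
  · refine le_trans ?_ (hN x)
    rw [← Set.ncard_coe_finset]
    refine le_trans (Set.ncard_le_ncard (t := C.wall '' {e | C.src e = x}) ?_
      ((hfin x).image _)) (Set.ncard_image_le (hfin x))
    exact fun h hh => hall h hh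
  · push Not at hall
    obtain ⟨h, hh, hne⟩ := hall
    obtain ⟨e, rfl, he⟩ := hC.exists_edge_half_subset (hA h hh)
    have heA : C.wall e ∉ A := fun hc => hne e rfl (hanti _ hc _ hh he)
    have hes := hC.mem_sep_of_half_subset (hA h hh) he
    have hAne : ∀ k ∈ A, k ≠ C.wall e := fun k hk hc => heA (hc ▸ hk)
    refine ih (x := C.tgt e) (fun k hk => ?_) (fun k hk l hl hkl => ?_) ?_
    · exact hC.mem_sep_tgt.2 (Or.inl ⟨hAne k hk, hA k hk⟩)
    · rw [hC.half_tgt (hAne k hk), hC.half_tgt (hAne l hl)] at hkl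
      exact hanti k hk l hl hkl
    · have := hC.ncard_sep_tgt hes
      omega

end SimplyConn

end FlagSquareComplex

/-! ### Face maps of cubes -/

/-- Reverse the unit interval if `b` is `true`. -/
def reflect (b : Bool) (t : I) : I := if b then σ t else t

@[simp] theorem reflect_false (t : I) : reflect false t = t := rfl

@[simp] theorem reflect_true (t : I) : reflect true t = σ t := rfl

theorem reflect_reflect (a b : Bool) (t : I) : reflect a (reflect b t) = reflect (xor a b) t := by
  cases a <;> cases b <;> simp

theorem abs_reflect_sub (b : Bool) (s t : I) :
    |(reflect b s : ℝ) - reflect b t| = |(s : ℝ) - t| := by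
  cases b
  · rfl
  · rw [reflect_true, reflect_true, unitInterval.coe_symm_eq, unitInterval.coe_symm_eq, abs_sub_comm]
    congr 1
    ring

theorem reflect_mem_Ioo {b : Bool} {t : I} : reflect b t ∈ Ioo 0 1 ↔ t ∈ Ioo 0 1 := by
  cases b
  · rfl
  · rw [reflect_true, mem_Ioo, mem_Ioo, unitInterval.pos_iff_ne_zero, unitInterval.lt_one_iff_ne_one,
      unitInterval.pos_iff_ne_zero, unitInterval.lt_one_iff_ne_one]
    simp [and_comm]

/-- The face map which puts the coordinate `i` in place `e i`, and then reverses the coordinates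
selected by `s`; the coordinates outside the range of `e` are `0` before this reversal. -/
noncomputable def faceMap {m n : ℕ} (e : Fin m ↪ Fin n) (s : Fin n → Bool) (x : Cube m) : Cube n :=
  fun j => reflect (s j) (Function.extend e x 0 j)

/-- The corners of a cube. -/
def corner {n : ℕ} (u : Fin n → Bool) : Cube n := fun j => reflect (u j) 0

/-- The label of the image of the corner labelled `u` under `faceMap e s`. -/
noncomputable def faceLabel {m n : ℕ} (e : Fin m ↪ Fin n) (s : Fin n → Bool) (u : Fin m → Bool) :
    Fin n → Bool :=
  fun j => xor (s j) (Function.extend e u (fun _ => false) j)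

section FaceMap

variable {k m n : ℕ} (e : Fin m ↪ Fin n) (s : Fin n → Bool)

@[simp] theorem faceMap_apply (x : Cube m) (i : Fin m) :
    faceMap e s x (e i) = reflect (s (e i)) (x i) := by
  rw [faceMap, e.injective.extend_apply]

theorem faceMap_of_notMem (x : Cube m) {j : Fin n} (hj : j ∉ range e) :
    faceMap e s x j = reflect (s j) 0 := by
  rw [faceMap, Function.extend_apply' _ _ _ hj]
  rfl

@[simp] theorem faceLabel_apply (u : Fin m → Bool) (i : Fin m) :
    faceLabel e s u (e i) = xor (s (e i)) (u i) := by
  rw [faceLabel, e.injective.extend_apply]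

theorem faceLabel_of_notMem (u : Fin m → Bool) {j : Fin n} (hj : j ∉ range e) :
    faceLabel e s u j = s j := by
  rw [faceLabel, Function.extend_apply' _ _ _ hj, Bool.xor_false]

@[simp] theorem faceLabel_false : faceLabel e s (fun _ => false) = s := by
  ext j
  by_cases hj : j ∈ range e
  · obtain ⟨i, rfl⟩ := hj
    simp
  · rw [faceLabel_of_notMem _ _ _ hj]

theorem faceMap_corner (u : Fin m → Bool) : faceMap e s (corner u) = corner (faceLabel e s u) := by
  ext j
  by_cases hj : j ∈ range e
  · obtain ⟨i, rfl⟩ := hj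
    simp [corner, reflect_reflect]
  · rw [faceMap_of_notMem _ _ _ hj, corner, faceLabel_of_notMem _ _ _ hj]

theorem faceMap_comp (e' : Fin k ↪ Fin m) (s' : Fin m → Bool) :
    faceMap e s ∘ faceMap e' s' = faceMap (e'.trans e) (faceLabel e s s') := by
  ext x j
  rw [Function.comp_apply]
  by_cases hj : j ∈ range e
  · obtain ⟨i, rfl⟩ := hj
    rw [faceMap_apply]
    by_cases hi : i ∈ range e'
    · obtain ⟨l, rfl⟩ := hi
      rw [← Function.Embedding.trans_apply, faceMap_apply, faceMap_apply, reflect_reflect]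
      simp
    · rw [faceMap_of_notMem _ _ _ hi, faceMap_of_notMem, reflect_reflect, faceLabel_apply]
      rintro ⟨l, hl⟩
      exact hi ⟨l, e.injective hl⟩
  · rw [faceMap_of_notMem _ _ _ hj, faceMap_of_notMem, faceLabel_of_notMem _ _ _ hj]
    rintro ⟨l, hl⟩
    exact hj ⟨e' l, hl⟩

theorem isFaceMap_faceMap : IsFaceMap (faceMap e s) := by
  refine ⟨e, fun i => ?_, fun j hj => ?_⟩
  · cases h : s (e i)
    · left; simp [h]
    · right; simp [h]
  · cases h : s j
    · left; simp [faceMap_of_notMem _ _ _ hj, h]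
    · right; simp [faceMap_of_notMem _ _ _ hj, h]

theorem IsFaceMap.exists_eq {f : Cube m → Cube n} (hf : IsFaceMap f) :
    ∃ e s, f = faceMap e s := by
  classical
  obtain ⟨e, h1, h2⟩ := hf
  have hs : ∀ j, ∃ b : Bool, (∀ i, e i = j → ∀ x, f x j = reflect b (x i)) ∧
      (j ∉ range e → ∀ x, f x j = reflect b 0) := by
    intro j
    by_cases hj : j ∈ range e
    · obtain ⟨i, rfl⟩ := hj
      rcases h1 i with h | h
      · exact ⟨false, fun i' hi x => by rw [e.injective hi]; exact h x,
          fun h' => absurd (mem_range_self i) h'⟩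
      · exact ⟨true, fun i' hi x => by rw [e.injective hi]; exact h x,
          fun h' => absurd (mem_range_self i) h'⟩
    · rcases h2 j hj with h | h
      · exact ⟨false, fun i hi => absurd ⟨i, hi⟩ hj, fun _ x => h x⟩
      · exact ⟨true, fun i hi => absurd ⟨i, hi⟩ hj, fun _ x => by simp [h x]⟩
  choose s hs1 hs2 using hs
  refine ⟨e, s, ?_⟩
  ext x j
  by_cases hj : j ∈ range e
  · obtain ⟨i, rfl⟩ := hj
    rw [faceMap_apply, hs1 _ i rfl]
  · rw [faceMap_of_notMem _ _ _ hj, hs2 _ hj]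

theorem faceMap_refl_false : faceMap (Function.Embedding.refl (Fin n)) (fun _ => false) = id := by
  ext x j
  exact congrArg Subtype.val (faceMap_apply (Function.Embedding.refl (Fin n)) _ x j)

theorem faceZero_eq (i : Fin (n + 1)) : faceZero i = faceMap i.succAboveEmb (fun _ => false) := by
  ext x j
  rcases Fin.eq_self_or_eq_succAbove i j with rfl | ⟨l, rfl⟩
  · rw [faceMap_of_notMem _ _ _ (by simp)]
    simp [faceZero]
  · have := faceMap_apply i.succAboveEmb (fun _ => false) x l
    rw [Fin.coe_succAboveEmb] at this
    rw [this]
    simp [faceZero]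

/-- Every point of a cube lies in the interior of a face. -/
theorem exists_faceMap_eq (y : Cube n) :
    ∃ (k : ℕ) (e : Fin k ↪ Fin n) (s : Fin n → Bool), ∃ z ∈ cubeInterior k, faceMap e s z = y := by
  classical
  let A : Finset (Fin n) := Finset.univ.filter fun j => y j ≠ 0 ∧ y j ≠ 1
  let e : Fin A.card ↪ Fin n := (A.orderEmbOfFin rfl).toEmbedding
  have he : ∀ j, j ∈ range e ↔ y j ≠ 0 ∧ y j ≠ 1 := by
    intro j
    have : range e = A := Finset.range_orderEmbOfFin A rfl
    rw [this]
    simp [A]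
  refine ⟨A.card, e, fun j => decide (y j = 1), fun i => y (e i), fun i => ?_, ?_⟩
  · have h := (he (e i)).1 (mem_range_self i)
    exact ⟨unitInterval.pos_iff_ne_zero.2 h.1, unitInterval.lt_one_iff_ne_one.2 h.2⟩
  · ext j
    by_cases hj : j ∈ range e
    · obtain ⟨i, rfl⟩ := hj
      simp [((he _).1 (mem_range_self i)).2]
    · rw [faceMap_of_notMem _ _ _ hj]
      by_cases h1 : y j = 1
      · simp [h1]
      · have h0 : y j = 0 := by
          by_contra h0
          exact hj ((he j).2 ⟨h0, h1⟩)
        simp [h0]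

end FaceMap

/-- Change the label `u` in place `i`. -/
def flipAt {n : ℕ} (u : Fin n → Bool) (i : Fin n) : Fin n → Bool := Function.update u i (!u i)

/-- The embedding of the one-element type with value `i`. -/
def single {n : ℕ} (i : Fin n) : Fin 1 ↪ Fin n := ⟨fun _ => i, fun _ _ _ => Subsingleton.elim _ _⟩

/-- The embedding of the two-element type with values `i` and `j`. -/
def pair {n : ℕ} (i j : Fin n) (h : i ≠ j) : Fin 2 ↪ Fin n :=
  ⟨![i, j], by
    intro a b hab
    fin_cases a <;> fin_cases b <;> simp_all [eq_comm]⟩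

/-- The edge of the cube at the corner `u` in direction `i`. -/
noncomputable def edgeMap {n : ℕ} (u : Fin n → Bool) (i : Fin n) : Cube 1 → Cube n :=
  faceMap (single i) u

/-- Reversal of the 1-cube. -/
noncomputable def revMap : Cube 1 → Cube 1 := faceMap (Function.Embedding.refl _) (fun _ => true)

section EdgeMap

variable {m n : ℕ}

theorem faceMap_comp_edgeMap (e : Fin m ↪ Fin n) (s : Fin n → Bool) (u : Fin m → Bool) (i : Fin m) :
    faceMap e s ∘ edgeMap u i = edgeMap (faceLabel e s u) (e i) := by
  rw [edgeMap, faceMap_comp]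
  rfl

theorem faceLabel_flipAt (e : Fin m ↪ Fin n) (s : Fin n → Bool) (u : Fin m → Bool) (i : Fin m) :
    faceLabel e s (flipAt u i) = flipAt (faceLabel e s u) (e i) := by
  ext j
  by_cases hj : j ∈ range e
  · obtain ⟨l, rfl⟩ := hj
    rw [faceLabel_apply]
    by_cases hl : l = i
    · subst hl
      simp [flipAt]
    · have : e l ≠ e i := fun h => hl (e.injective h)
      simp [flipAt, hl, this]
  · have : j ≠ e i := fun h => hj ⟨i, h.symm⟩
    rw [faceLabel_of_notMem _ _ _ hj, flipAt, Function.update_of_ne this,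
      faceLabel_of_notMem _ _ _ hj]

theorem edgeMap_comp_revMap (u : Fin n → Bool) (i : Fin n) :
    edgeMap u i ∘ revMap = edgeMap (flipAt u i) i := by
  rw [edgeMap, revMap, faceMap_comp, edgeMap]
  congr 1
  have h := faceLabel_flipAt (single i) u (fun _ => false) 0
  rw [faceLabel_false] at h
  rw [show flipAt u i = flipAt u (single i 0) from rfl, ← h]
  congr 1
  ext l
  rw [Subsingleton.elim l 0]
  simp [flipAt]

theorem revMap_comp_revMap : revMap ∘ revMap = id := by
  rw [revMap, faceMap_comp, ← faceMap_refl_false]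
  congr 1
  ext l
  have := faceLabel_apply (Function.Embedding.refl (Fin 1)) (fun _ => true) (fun _ => true) l
  simpa using this

theorem edgeMap_corner_false (u : Fin n → Bool) (i : Fin n) :
    edgeMap u i (corner fun _ => false) = corner u := by
  rw [edgeMap, faceMap_corner, faceLabel_false]

theorem edgeMap_corner_true (u : Fin n → Bool) (i : Fin n) :
    edgeMap u i (corner fun _ => true) = corner (flipAt u i) := by
  rw [← edgeMap_corner_false _ i, ← edgeMap_comp_revMap, Function.comp_apply, revMap,
    faceMap_corner, faceLabel_false]

theorem edgeMap_one : edgeMap (fun _ : Fin 1 => false) 0 = id := by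
  rw [← faceMap_refl_false, edgeMap]
  congr 1
  ext l
  rw [Subsingleton.elim (single 0 l)]

end EdgeMap

theorem flipAt_comm {n : ℕ} (u : Fin n → Bool) {i j : Fin n} (h : i ≠ j) :
    flipAt (flipAt u i) j = flipAt (flipAt u j) i := by
  simp only [flipAt, Function.update_of_ne h, Function.update_of_ne h.symm]
  exact Function.update_comm h _ _ _

@[simp] theorem flipAt_flipAt {n : ℕ} (u : Fin n → Bool) (i : Fin n) :
    flipAt (flipAt u i) i = u := by
  simp [flipAt]

/-! ### The flag square complex of a nonpositively curved cube complex -/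

namespace CubeComplex

variable {X : Type w} [TopologicalSpace X] (K : CubeComplex X)

theorem comp_faceMap_mem {m n : ℕ} {c : Cube n → X} (hc : c ∈ K.cubes n) (e : Fin m ↪ Fin n)
    (s : Fin n → Bool) : c ∘ faceMap e s ∈ K.cubes m :=
  K.comp_mem hc (isFaceMap_faceMap e s)

/-- Parametrized edges as oriented edges. -/
abbrev Edge : Type w := {c : Cube 1 → X // c ∈ K.cubes 1}

/-- The vertices of a cube complex, as points. -/
abbrev Vertex : Type w := {p : X // (fun _ : Cube 0 => p) ∈ K.cubes 0}

/-- `a` and `b` are the sides at one corner of a square, `a'` and `b'` are the opposite sides. -/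
def IsSq (a b a' b' : Cube 1 → X) : Prop :=
  ∃ s ∈ K.cubes 2, a = s ∘ edgeMap (fun _ => false) 0 ∧ b = s ∘ edgeMap (fun _ => false) 1 ∧
    a' = s ∘ edgeMap (flipAt (fun _ => false) 1) 0 ∧ b' = s ∘ edgeMap (flipAt (fun _ => false) 0) 1

theorem isSq_of_cube {n : ℕ} {c : Cube n → X} (hc : c ∈ K.cubes n) (u : Fin n → Bool)
    {i j : Fin n} (h : i ≠ j) :
    K.IsSq (c ∘ edgeMap u i) (c ∘ edgeMap u j) (c ∘ edgeMap (flipAt u j) i)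
      (c ∘ edgeMap (flipAt u i) j) := by
  have h0 : pair i j h 0 = i := rfl
  have h1 : pair i j h 1 = j := rfl
  refine ⟨c ∘ faceMap (pair i j h) u, K.comp_faceMap_mem hc _ _, ?_, ?_, ?_, ?_⟩ <;>
    simp only [Function.comp_assoc, faceMap_comp_edgeMap, faceLabel_flipAt, faceLabel_false, h0, h1]

variable {K}

theorem corner_mem {n : ℕ} {c : Cube n → X} (hc : c ∈ K.cubes n) (u : Fin n → Bool) :
    (fun _ : Cube 0 => c (corner u)) ∈ K.cubes 0 := by
  have h := K.comp_faceMap_mem hc (⟨Fin.elim0, fun i => i.elim0⟩ : Fin 0 ↪ Fin n) u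
  convert h using 1
  ext x
  rw [Function.comp_apply, Subsingleton.elim x (corner fun _ => false), faceMap_corner,
    faceLabel_false]

theorem faceZero_one_eq : faceZero (n := 1) 1 = edgeMap (fun _ => false) 0 := by
  rw [faceZero_eq, edgeMap]
  congr 1
  ext l
  rw [Subsingleton.elim l 0]
  rfl

theorem faceZero_zero_eq : faceZero (n := 1) 0 = edgeMap (fun _ => false) 1 := by
  rw [faceZero_eq, edgeMap]
  congr 1
  ext l
  rw [Subsingleton.elim l 0]
  rfl

theorem IsSq.exists_link {a b a' b' : Cube 1 → X} (h : K.IsSq a b a' b') :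
    ∃ c ∈ K.cubes 0, K.LinkVertex c a ∧ K.LinkVertex c b ∧ ∃ s, K.LinkEdge a b s ∧
      a' = s ∘ edgeMap (flipAt (fun _ => false) 1) 0 ∧
      b' = s ∘ edgeMap (flipAt (fun _ => false) 0) 1 := by
  obtain ⟨s, hs, rfl, rfl, h1, h2⟩ := h
  refine ⟨_, corner_mem hs fun _ => false, ⟨K.comp_faceMap_mem hs _ _, ?_⟩,
    ⟨K.comp_faceMap_mem hs _ _, ?_⟩, s, ⟨hs, ?_, ?_⟩, h1, h2⟩
  · ext x
    simp only [Function.comp_apply]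
    rw [faceZero_eq, Subsingleton.elim x (corner fun _ => false), faceMap_corner, faceLabel_false,
      edgeMap_corner_false]
  · ext x
    simp only [Function.comp_apply]
    rw [faceZero_eq, Subsingleton.elim x (corner fun _ => false), faceMap_corner, faceLabel_false,
      edgeMap_corner_false]
  · rw [faceZero_one_eq]
  · rw [faceZero_zero_eq]

/-- The oriented edges and the squares of a nonpositively curved cube complex. -/
noncomputable def flagSquareComplex (hK : K.NonpositivelyCurved) :
    FlagSquareComplex K.Vertex K.Edge where
  src e := ⟨_, corner_mem e.2 fun _ => false⟩
  tgt e := ⟨_, corner_mem e.2 fun _ => true⟩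
  inv e := ⟨e.1 ∘ revMap, K.comp_faceMap_mem e.2 _ _⟩
  Sq a b a' b' := K.IsSq a.1 b.1 a'.1 b'.1
  inv_inv e := Subtype.ext (by
    change e.1 ∘ (revMap ∘ revMap) = e.1
    rw [revMap_comp_revMap, Function.comp_id])
  src_inv e := Subtype.ext (by
    change e.1 (revMap (corner fun _ => false)) = _
    rw [revMap, faceMap_corner, faceLabel_false])
  src_eq := by
    rintro ⟨a, ha⟩ ⟨b, hb⟩ ⟨a', ha'⟩ ⟨b', hb'⟩ ⟨s, hs, h1, h2, h3, h4⟩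
    refine Subtype.ext ?_
    dsimp only at h1 h2 h3 h4 ⊢
    rw [h1, h2, Function.comp_apply, Function.comp_apply, edgeMap_corner_false,
      edgeMap_corner_false]
  tgt_eq := by
    rintro ⟨a, ha⟩ ⟨b, hb⟩ ⟨a', ha'⟩ ⟨b', hb'⟩ ⟨s, hs, h1, h2, h3, h4⟩
    refine Subtype.ext ?_
    dsimp only at h1 h2 h3 h4 ⊢
    rw [h1, h4, Function.comp_apply, Function.comp_apply, edgeMap_corner_false,
      edgeMap_corner_true]
  tgt_eq' := by
    rintro ⟨a, ha⟩ ⟨b, hb⟩ ⟨a', ha'⟩ ⟨b', hb'⟩ ⟨s, hs, h1, h2, h3, h4⟩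
    refine Subtype.ext ?_
    dsimp only at h1 h2 h3 h4 ⊢
    rw [h3, h4, Function.comp_apply, Function.comp_apply, edgeMap_corner_true,
      edgeMap_corner_true, flipAt_comm _ zero_ne_one]
  symm := by
    rintro ⟨a, ha⟩ ⟨b, hb⟩ ⟨a', ha'⟩ ⟨b', hb'⟩ ⟨s, hs, h1, h2, h3, h4⟩
    dsimp only at h1 h2 h3 h4 ⊢
    subst h1 h2 h3 h4
    exact K.isSq_of_cube hs _ one_ne_zero
  rot := by
    rintro ⟨a, ha⟩ ⟨b, hb⟩ ⟨a', ha'⟩ ⟨b', hb'⟩ ⟨s, hs, h1, h2, h3, h4⟩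
    dsimp only at h1 h2 h3 h4 ⊢
    subst h1 h2 h3 h4
    rw [Function.comp_assoc, Function.comp_assoc, edgeMap_comp_revMap, edgeMap_comp_revMap,
      flipAt_comm _ one_ne_zero]
    have := K.isSq_of_cube hs (flipAt (fun _ => false) 0) zero_ne_one
    rwa [flipAt_flipAt] at this
  ne := by
    rintro ⟨a, ha⟩ ⟨b, hb⟩ ⟨a', ha'⟩ ⟨b', hb'⟩ h hab
    obtain rfl : a = b := congrArg Subtype.val hab
    obtain ⟨c, hc, h1, -, s, h2, -⟩ := h.exists_link
    exact hK.no_loops hc h1 h2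
  uniq := by
    rintro ⟨a, ha⟩ ⟨b, hb⟩ ⟨a₁, ha₁⟩ ⟨b₁, hb₁⟩ ⟨a₂, ha₂⟩ ⟨b₂, hb₂⟩ h h'
    obtain ⟨c, hc, h1, h2, s, h3, h4, h5⟩ := h.exists_link
    obtain ⟨c', hc', h1', h2', s', h3', h4', h5'⟩ := h'.exists_link
    obtain rfl := hK.no_bigons hc h1 h2 h3 h3'
    exact ⟨Subtype.ext (h4.trans h4'.symm), Subtype.ext (h5.trans h5'.symm)⟩
  cube := by
    rintro ⟨a, ha⟩ ⟨b, hb⟩ ⟨c, hc⟩ ⟨a₁, ha₁⟩ ⟨b₁, hb₁⟩ ⟨b₂, hb₂⟩ ⟨c₂, hc₂⟩ ⟨a₃, ha₃⟩ ⟨c₃, hc₃⟩ h h' h''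
    obtain ⟨x, hx, k1, k2, s, k3, k4, k5⟩ := h.exists_link
    obtain ⟨x', hx', l1, l2, t, l3, l4, l5⟩ := h'.exists_link
    obtain ⟨x'', hx'', m1, m2, r, m3, m4, m5⟩ := h''.exists_link
    obtain rfl : x = x' := k2.2.symm.trans l1.2
    obtain rfl : x = x'' := k1.2.symm.trans m1.2
    obtain ⟨q, hq, rfl, rfl, rfl⟩ := hK.no_triangles hx k1 k2 l2 k3 l3 m3
    dsimp only at *
    have e20 : (2 : Fin 3).succAboveEmb 0 = 0 := rfl
    have e21 : (2 : Fin 3).succAboveEmb 1 = 1 := rfl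
    have e00 : (0 : Fin 3).succAboveEmb 0 = 1 := rfl
    have e01 : (0 : Fin 3).succAboveEmb 1 = 2 := rfl
    have e10 : (1 : Fin 3).succAboveEmb 0 = 0 := rfl
    have e11 : (1 : Fin 3).succAboveEmb 1 = 2 := rfl
    simp only [Function.comp_assoc, faceZero_eq, faceMap_comp_edgeMap, faceLabel_flipAt,
      faceLabel_false, e20, e21, e00, e01, e10, e11] at k4 k5 l4 l5 m4 m5
    subst k4 k5 l4 l5 m4 m5
    have h01 : (0 : Fin 3) ≠ 1 := by decide
    have h02 : (0 : Fin 3) ≠ 2 := by decide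
    have h12 : (1 : Fin 3) ≠ 2 := by decide
    let u : Fin 3 → Bool := fun _ => false
    refine ⟨⟨q ∘ edgeMap (flipAt (flipAt u 1) 2) 0, K.comp_faceMap_mem hq _ _⟩,
      ⟨q ∘ edgeMap (flipAt (flipAt u 0) 2) 1, K.comp_faceMap_mem hq _ _⟩,
      ⟨q ∘ edgeMap (flipAt (flipAt u 0) 1) 2, K.comp_faceMap_mem hq _ _⟩, ?_, ?_, ?_⟩
    · exact K.isSq_of_cube hq (flipAt u 0) h12
    · have := K.isSq_of_cube hq (flipAt u 1) h02
      rwa [flipAt_comm u h01.symm] at this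
    · have := K.isSq_of_cube hq (flipAt u 2) h01
      rwa [flipAt_comm u h12.symm, flipAt_comm u h02.symm] at this

end CubeComplex

/-! ### Flat cocycles on a cube -/

section Flat

variable {n : ℕ} {Γ : Type*} [Group Γ]

/-- A cocycle on the edges of a cube which is flat on its squares has a potential. -/
theorem exists_potential (F : (Fin n → Bool) → Fin n → Γ)
    (h1 : ∀ u i, F (flipAt u i) i = (F u i)⁻¹)
    (h2 : ∀ u i j, i ≠ j → F u i * F (flipAt u i) j = F u j * F (flipAt u j) i) :
    ∃ ψ : (Fin n → Bool) → Γ, ∀ u i, ψ (flipAt u i) = ψ u * F u i := by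
  suffices h : ∀ S : Finset (Fin n), ∃ ψ : (Fin n → Bool) → Γ,
      ∀ u, ∀ i ∈ S, ψ (flipAt u i) = ψ u * F u i by
    obtain ⟨ψ, hψ⟩ := h Finset.univ
    exact ⟨ψ, fun u i => hψ u i (Finset.mem_univ i)⟩
  intro S
  induction S using Finset.induction_on with
  | empty => exact ⟨fun _ => 1, by simp⟩
  | insert j S hj ih =>
    obtain ⟨ψ, hψ⟩ := ih
    refine ⟨fun u => if u j then ψ (flipAt u j) * F (flipAt u j) j else ψ u, fun u i hi => ?_⟩
    by_cases hij : i = j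
    · subst hij
      have hf : flipAt u i i = !u i := by simp [flipAt]
      cases hu : u i
      · simp [hf, hu]
      · simp [hf, hu, h1]
    · have hi : i ∈ S := (Finset.mem_insert.1 hi).resolve_left hij
      have hf : flipAt u i j = u j := Function.update_of_ne (Ne.symm hij) _ _
      cases hu : u j
      · simp [hf, hu, hψ u i hi]
      · have := h2 (flipAt u j) i j hij
        rw [flipAt_flipAt] at this
        simp only [hf, hu, if_true]
        rw [flipAt_comm u hij, hψ _ i hi, mul_assoc, mul_assoc, this]

/-- A function on the corners of a cube that agrees at adjacent corners is constant. -/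
theorem eq_of_flipAt_eq {α : Type*} (g : (Fin n → Bool) → α) (h : ∀ u i, g (flipAt u i) = g u)
    (u v : Fin n → Bool) : g u = g v := by
  suffices h : ∀ S : Finset (Fin n), g (S.piecewise v u) = g u by
    simpa using (h Finset.univ).symm
  intro S
  induction S using Finset.induction_on with
  | empty => simp
  | insert j S hj ih =>
    rw [Finset.piecewise_insert, ← ih]
    by_cases hv : v j = S.piecewise v u j
    · rw [hv, Function.update_eq_self]
    · rw [← h (S.piecewise v u) j, flipAt]
      congr 2
      exact Bool.eq_not_of_ne hv

end Flat

namespace CubeComplex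

variable {X : Type w} {Γ : Type v} [Group Γ] (φ : (Cube 1 → X) → Γ)

/-- A potential of `φ` on the corners of the cube `d`, which exists if `φ` is a cocycle and `d`
belongs to the complex, and is arbitrary otherwise. -/
noncomputable def potential {n : ℕ} (d : Cube n → X) : (Fin n → Bool) → Γ :=
  Classical.epsilon fun ψ => ∀ u i, ψ (flipAt u i) = ψ u * φ (d ∘ edgeMap u i)

/-- Parallel transport of `φ` in the cube `d` from the corner `u` to the corner `v`. -/
noncomputable def transport {n : ℕ} (d : Cube n → X) (u v : Fin n → Bool) : Γ :=
  (potential φ d u)⁻¹ * potential φ d v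

theorem transport_self {n : ℕ} (d : Cube n → X) (u : Fin n → Bool) : transport φ d u u = 1 :=
  inv_mul_cancel _

theorem transport_mul {n : ℕ} (d : Cube n → X) (u v t : Fin n → Bool) :
    transport φ d u v * transport φ d v t = transport φ d u t := by
  simp [transport, mul_assoc]

variable [TopologicalSpace X] (K : CubeComplex X)

/-- A function on parametrized edges with values in a group, compatible with reversal and flat on
squares. -/
structure IsCocycle : Prop where
  rev : ∀ c ∈ K.cubes 1, φ (c ∘ revMap) = (φ c)⁻¹
  sq : ∀ {a b a' b'}, K.IsSq a b a' b' → φ a * φ b' = φ b * φ a'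

variable {K φ}

theorem IsCocycle.potential_flipAt (hφ : K.IsCocycle φ) {n : ℕ} {d : Cube n → X}
    (hd : d ∈ K.cubes n) (u : Fin n → Bool) (i : Fin n) :
    potential φ d (flipAt u i) = potential φ d u * φ (d ∘ edgeMap u i) := by
  refine Classical.epsilon_spec
    (p := fun ψ : (Fin n → Bool) → Γ => ∀ u i, ψ (flipAt u i) = ψ u * φ (d ∘ edgeMap u i))
    (exists_potential _ (fun u i => ?_) (fun u i j h => ?_)) u i
  · rw [← edgeMap_comp_revMap, ← Function.comp_assoc]
    exact hφ.rev _ (K.comp_faceMap_mem hd (single i) u)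
  · exact hφ.sq (K.isSq_of_cube hd u h)

/-- Parallel transport in a face agrees with parallel transport in the cube. -/
theorem IsCocycle.transport_comp (hφ : K.IsCocycle φ) {m n : ℕ} {d : Cube n → X}
    (hd : d ∈ K.cubes n) (e : Fin m ↪ Fin n) (s : Fin n → Bool) (u v : Fin m → Bool) :
    transport φ (d ∘ faceMap e s) u v = transport φ d (faceLabel e s u) (faceLabel e s v) := by
  have h := eq_of_flipAt_eq
    (fun u => potential φ d (faceLabel e s u) * (potential φ (d ∘ faceMap e s) u)⁻¹)
    (fun u i => by
      rw [hφ.potential_flipAt (K.comp_faceMap_mem hd e s), faceLabel_flipAt,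
        hφ.potential_flipAt hd, Function.comp_assoc, faceMap_comp_edgeMap]
      group) u v
  rw [mul_inv_eq_iff_eq_mul] at h
  rw [transport, transport, h]
  group

theorem IsCocycle.transport_edge (hφ : K.IsCocycle φ) {c : Cube 1 → X} (hc : c ∈ K.cubes 1) :
    transport φ c (fun _ => false) (fun _ => true) = φ c := by
  have h := hφ.potential_flipAt hc (fun _ => false) 0
  rw [edgeMap_one, Function.comp_id] at h
  rw [transport, ← inv_mul_eq_iff_eq_mul.2 h]
  congr 2
  ext l
  rw [Subsingleton.elim l 0]
  simp [flipAt]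

variable (K)

/-! ### Neighbourhoods of points -/

/-- The dimension of the open cube that contains `p`. -/
noncomputable def dimAt (p : X) : ℕ := (K.exists_cube p).choose

/-- A parametrization of the cube that contains `p` in its interior. -/
noncomputable def cubeAt (p : X) : Cube (K.dimAt p) → X := (K.exists_cube p).choose_spec.choose

theorem cubeAt_mem (p : X) : K.cubeAt p ∈ K.cubes (K.dimAt p) :=
  (K.exists_cube p).choose_spec.choose_spec.1

/-- The coordinates of `p` in the open cube that contains it. -/
noncomputable def posAt (p : X) : Cube (K.dimAt p) :=
  (K.exists_cube p).choose_spec.choose_spec.2.choose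

theorem posAt_mem (p : X) : K.posAt p ∈ cubeInterior (K.dimAt p) :=
  (K.exists_cube p).choose_spec.choose_spec.2.choose_spec.1

theorem cubeAt_posAt (p : X) : K.cubeAt p (K.posAt p) = p :=
  (K.exists_cube p).choose_spec.choose_spec.2.choose_spec.2

theorem exists_eps {n : ℕ} {x : Cube n} (hx : x ∈ cubeInterior n) :
    ∃ ε : ℝ, 0 < ε ∧ ε ≤ 1 / 2 ∧ ∀ i, 2 * ε ≤ x i ∧ (x i : ℝ) ≤ 1 - 2 * ε := by
  have h : ∀ᶠ ε : ℝ in 𝓝[>] 0, ε ≤ 1 / 2 ∧ ∀ i, 2 * ε ≤ x i ∧ (x i : ℝ) ≤ 1 - 2 * ε := by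
    have h0 : ∀ᶠ ε : ℝ in 𝓝[>] 0, ε ≤ 1 / 2 :=
      mem_nhdsWithin_of_mem_nhds (Iic_mem_nhds (by norm_num))
    refine h0.and (eventually_all.2 fun i => ?_)
    have h0 : (0 : ℝ) < x i := (hx i).1
    have h1 : (x i : ℝ) < 1 := (hx i).2
    filter_upwards [mem_nhdsWithin_of_mem_nhds (Iic_mem_nhds (show (0 : ℝ) < x i / 2 by linarith)),
      mem_nhdsWithin_of_mem_nhds (Iic_mem_nhds (show (0 : ℝ) < (1 - x i) / 2 by linarith))]
      with ε h2 h3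
    rw [mem_Iic] at h2 h3
    constructor <;> linarith
  obtain ⟨ε, h1, h2⟩ := (h.and self_mem_nhdsWithin).exists
  exact ⟨ε, h2, h1⟩

/-- A radius that is small with respect to the distance from `p` to the boundary of the open cube
that contains it. -/
noncomputable def epsAt (p : X) : ℝ := (exists_eps (K.posAt_mem p)).choose

theorem epsAt_pos (p : X) : 0 < K.epsAt p := (exists_eps (K.posAt_mem p)).choose_spec.1

theorem epsAt_le (p : X) : K.epsAt p ≤ 1 / 2 := (exists_eps (K.posAt_mem p)).choose_spec.2.1

theorem le_posAt (p : X) (i) : 2 * K.epsAt p ≤ K.posAt p i ∧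
    (K.posAt p i : ℝ) ≤ 1 - 2 * K.epsAt p := (exists_eps (K.posAt_mem p)).choose_spec.2.2 i

/-- The cube `cubeAt p` is the face `faceMap e s` of the cube `d`, and `y` is close to the copy of
`p` in this face. -/
structure Near (p : X) {m : ℕ} (d : Cube m → X) (y : Cube m) (e : Fin (K.dimAt p) ↪ Fin m)
    (s : Fin m → Bool) : Prop where
  face : d ∘ faceMap e s = K.cubeAt p
  lt : ∀ j, |(y j : ℝ) - faceMap e s (K.posAt p) j| < K.epsAt p

variable {K}

theorem two_eps_le_abs {p : X} (i : Fin (K.dimAt p)) (a b : Bool) :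
    2 * K.epsAt p ≤ |(reflect a (K.posAt p i) : ℝ) - reflect b 0| := by
  have h := K.le_posAt p i
  have h0 := K.epsAt_pos p
  cases a <;> cases b <;> simp [abs_sub_comm] <;>
    first
      | exact le_trans (by linarith) (le_abs_self _)
      | exact le_trans (by linarith) (neg_le_abs _)

theorem eq_of_abs_reflect_lt {a b : Bool} (h : |(reflect a 0 : ℝ) - reflect b 0| < 1) : a = b := by
  cases a <;> cases b <;> simp at h ⊢

/-- If the point `y` of `d` is near `p` and lies in a face of `d`, then the cube of `p` is a face of
this face: the coordinates of `p` in its own cube are too far from `0` and `1` for `y` to be on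
another face. -/
theorem Near.restrict {p : X} {k m : ℕ} {d : Cube m → X} {y : Cube m}
    {e : Fin (K.dimAt p) ↪ Fin m} {s : Fin m → Bool} (h : K.Near p d y e s)
    {e₁ : Fin k ↪ Fin m} {s₁ : Fin m → Bool} {z : Cube k} (hy : faceMap e₁ s₁ z = y) :
    ∃ e' s', K.Near p (d ∘ faceMap e₁ s₁) z e' s' ∧ s = faceLabel e₁ s₁ s' := by
  subst hy
  have hε := K.epsAt_pos p
  have hε' := K.epsAt_le p
  have hr : ∀ i, ∃ l, e₁ l = e i := by
    intro i
    by_contra hc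
    have h1 := h.lt (e i)
    rw [faceMap_of_notMem _ _ _ (by simpa using hc), faceMap_apply, abs_sub_comm] at h1
    have h2 := two_eps_le_abs i (s (e i)) (s₁ (e i))
    linarith
  choose e' he' using hr
  have he'i : Function.Injective e' := fun i j hij => e.injective (by rw [← he', ← he', hij])
  let e'' : Fin (K.dimAt p) ↪ Fin k := ⟨e', he'i⟩
  have hee : e''.trans e₁ = e := by
    ext i
    exact congrArg Fin.val (he' i)
  have hs : s = faceLabel e₁ s₁ fun l => xor (s₁ (e₁ l)) (s (e₁ l)) := by
    ext j
    by_cases hj : j ∈ range e₁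
    · obtain ⟨l, rfl⟩ := hj
      simp
    · rw [faceLabel_of_notMem _ _ _ hj]
      have hj' : j ∉ range e := by
        rintro ⟨i, rfl⟩
        exact hj ⟨_, he' i⟩
      have h1 := h.lt j
      rw [faceMap_of_notMem _ _ _ hj, faceMap_of_notMem _ _ _ hj'] at h1
      exact (eq_of_abs_reflect_lt (by linarith)).symm
  have hc : faceMap e₁ s₁ ∘ faceMap e'' (fun l => xor (s₁ (e₁ l)) (s (e₁ l))) = faceMap e s := by
    rw [faceMap_comp, hee, ← hs]
  refine ⟨e'', fun l => xor (s₁ (e₁ l)) (s (e₁ l)), ⟨?_, fun l => ?_⟩, hs⟩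
  · rw [Function.comp_assoc, hc, h.face]
  · have h1 := h.lt (e₁ l)
    rwa [← hc, Function.comp_apply, faceMap_apply, faceMap_apply, abs_reflect_sub] at h1

/-- Nearness in a face implies nearness in the cube. -/
theorem Near.extend {p : X} {k m : ℕ} {d : Cube m → X} {e₁ : Fin k ↪ Fin m} {s₁ : Fin m → Bool}
    {z : Cube k} {e : Fin (K.dimAt p) ↪ Fin k} {s : Fin k → Bool}
    (h : K.Near p (d ∘ faceMap e₁ s₁) z e s) :
    K.Near p d (faceMap e₁ s₁ z) (e.trans e₁) (faceLabel e₁ s₁ s) := by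
  refine ⟨?_, fun j => ?_⟩
  · rw [← faceMap_comp, ← Function.comp_assoc, h.face]
  · rw [← faceMap_comp, Function.comp_apply]
    by_cases hj : j ∈ range e₁
    · obtain ⟨l, rfl⟩ := hj
      rw [faceMap_apply, faceMap_apply, abs_reflect_sub]
      exact h.lt l
    · rw [faceMap_of_notMem _ _ _ hj, faceMap_of_notMem _ _ _ hj, sub_self, abs_zero]
      exact K.epsAt_pos p

/-- A point of a cube may be near `p` with respect to only one way of placing the cube of `p`, as far
as the place of its first corner is concerned. -/
theorem Near.label_unique {p : X} {m : ℕ} {d : Cube m → X} {y : Cube m}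
    {e e' : Fin (K.dimAt p) ↪ Fin m} {s s' : Fin m → Bool} (h : K.Near p d y e s)
    (h' : K.Near p d y e' s') : s = s' := by
  have hε := K.epsAt_pos p
  have hε' := K.epsAt_le p
  have hdist : ∀ j, |(faceMap e s (K.posAt p) j : ℝ) - faceMap e' s' (K.posAt p) j|
      < 2 * K.epsAt p := by
    intro j
    have h1 := h.lt j
    have h2 := h'.lt j
    rw [abs_sub_comm] at h1
    calc _ ≤ _ := abs_sub_le _ (y j : ℝ) _
      _ < _ := by linarith
  have hr : ∀ {e e' : Fin (K.dimAt p) ↪ Fin m} {s s' : Fin m → Bool},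
      (∀ j, |(faceMap e s (K.posAt p) j : ℝ) - faceMap e' s' (K.posAt p) j| < 2 * K.epsAt p) →
      ∀ i, e i ∈ range e' := by
    intro e e' s s' hdist i
    by_contra hc
    have h1 := hdist (e i)
    rw [faceMap_apply, faceMap_of_notMem _ _ _ hc] at h1
    have h2 := two_eps_le_abs i (s (e i)) (s' (e i))
    linarith
  have hr1 := hr hdist
  have hr2 := hr fun j => by rw [abs_sub_comm]; exact hdist j
  have hoff : ∀ j, j ∉ range e → s j = s' j := by
    intro j hj
    have hj' : j ∉ range e' := by
      rintro ⟨i, rfl⟩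
      exact hj (hr2 i)
    have h1 := hdist j
    rw [faceMap_of_notMem _ _ _ hj, faceMap_of_notMem _ _ _ hj'] at h1
    exact eq_of_abs_reflect_lt (by linarith)
  -- the two copies of a generic interior point in the face agree, since open cubes are embedded
  let t : I := ⟨1 / 4, by norm_num, by norm_num⟩
  let z : Cube (K.dimAt p) := fun _ => t
  have ht : t ∈ Ioo (0 : I) 1 := by
    constructor
    · change (0 : ℝ) < 1 / 4
      norm_num
    · change (1 / 4 : ℝ) < 1
      norm_num
  let z' : Cube (K.dimAt p) := fun i => reflect (s (e i)) (faceMap e' s' z (e i))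
  have hz : z ∈ cubeInterior (K.dimAt p) := fun _ => ht
  have hz' : z' ∈ cubeInterior (K.dimAt p) := by
    intro i
    obtain ⟨i', hi'⟩ := hr1 i
    change reflect (s (e i)) (faceMap e' s' z (e i)) ∈ Ioo (0 : I) 1
    rw [← hi', faceMap_apply, reflect_mem_Ioo, reflect_mem_Ioo]
    exact ht
  have hzz : faceMap e s z' = faceMap e' s' z := by
    ext j
    by_cases hj : j ∈ range e
    · obtain ⟨i, rfl⟩ := hj
      rw [faceMap_apply, reflect_reflect, Bool.xor_self, reflect_false]
    · have hj' : j ∉ range e' := by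
        rintro ⟨i, rfl⟩
        exact hj (hr2 i)
      rw [faceMap_of_notMem _ _ _ hj, faceMap_of_notMem _ _ _ hj', hoff j hj]
  have heq : z' = z := by
    refine K.injOn (K.cubeAt_mem p) hz' hz ?_
    rw [← h.face, Function.comp_apply, hzz, h.face, ← h'.face, Function.comp_apply]
  ext j
  by_cases hj : j ∈ range e
  · obtain ⟨i, rfl⟩ := hj
    obtain ⟨i', hi'⟩ := hr1 i
    have h1 := congrFun hzz (e i)
    rw [heq, faceMap_apply, ← hi', faceMap_apply] at h1
    rw [← hi']
    change reflect (s (e' i')) t = reflect (s' (e' i')) t at h1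
    have h2 : t ≠ σ t := by
      intro h
      have := congrArg (Subtype.val : I → ℝ) h
      rw [unitInterval.coe_symm_eq] at this
      norm_num [t] at this
    cases h3 : s (e' i') <;> cases h4 : s' (e' i') <;> simp [h3, h4] at h1 ⊢
    · exact h2 h1
    · exact h2 h1.symm
  · rw [hoff j hj]

variable (K) in
/-- The cube that contains a point of a cube in its interior is a face of the latter. -/
theorem exists_faceMap_cubeAt {m : ℕ} {d : Cube m → X} (hd : d ∈ K.cubes m) (y : Cube m) :
    ∃ e s, d ∘ faceMap e s = K.cubeAt (d y) ∧ faceMap e s (K.posAt (d y)) = y := by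
  obtain ⟨k, e, s, z, hz, rfl⟩ := exists_faceMap_eq y
  obtain ⟨f, hf, h1, h2⟩ := K.eq_comp (K.comp_faceMap_mem hd e s) (K.cubeAt_mem _) z hz _
    (K.posAt_mem (d (faceMap e s z))) (K.cubeAt_posAt _).symm
  obtain ⟨e', s', rfl⟩ := hf.exists_eq
  refine ⟨e'.trans e, faceLabel e s s', ?_, ?_⟩
  · rw [h2, ← faceMap_comp, Function.comp_assoc]
  · rw [← faceMap_comp, Function.comp_apply, h1]

/-- Every point of a cube is near itself. -/
theorem near_self {m : ℕ} {d : Cube m → X} {y : Cube m} {e : Fin (K.dimAt (d y)) ↪ Fin m}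
    {s : Fin m → Bool} (h1 : d ∘ faceMap e s = K.cubeAt (d y))
    (h2 : faceMap e s (K.posAt (d y)) = y) : K.Near (d y) d y e s :=
  ⟨h1, fun j => by rw [h2, sub_self, abs_zero]; exact K.epsAt_pos _⟩

theorem isOpen_near {p : X} {m : ℕ} (d : Cube m → X) (e : Fin (K.dimAt p) ↪ Fin m)
    (s : Fin m → Bool) : IsOpen {y | K.Near p d y e s} := by
  by_cases h : d ∘ faceMap e s = K.cubeAt p
  · have : {y | K.Near p d y e s} =
        ⋂ j, {y : Cube m | |(y j : ℝ) - faceMap e s (K.posAt p) j| < K.epsAt p} := by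
      ext y
      simp only [mem_ofPred_eq, mem_iInter]
      exact ⟨fun h => h.lt, fun h' => ⟨h, h'⟩⟩
    rw [this]
    refine isOpen_iInter_of_finite fun j => isOpen_lt ?_ continuous_const
    exact (((continuous_subtype_val.comp (continuous_apply j)).sub continuous_const)).abs
  · convert isOpen_empty
    ext y
    simp only [mem_ofPred_eq, mem_empty_iff_false, iff_false]
    exact fun h' => h h'.face

end CubeComplex

/-! ### The covering space of a cocycle -/

namespace CubeComplex

variable {X : Type w} [TopologicalSpace X] (K : CubeComplex X) {Γ : Type v} [Group Γ]
  {φ : (Cube 1 → X) → Γ}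

/-- The points near `p`. -/
def nearSet (p : X) : Set X := {r | ∃ e s, K.Near p (K.cubeAt r) (K.posAt r) e s}

open Classical in
/-- In the cube of a point `r` near `p`, the corner which is the first corner of the
cube of `p`; an arbitrary corner if `r` is not near `p`. -/
noncomputable def baseLabel (p r : X) : Fin (K.dimAt r) → Bool :=
  if h : ∃ s e, K.Near p (K.cubeAt r) (K.posAt r) e s then h.choose else fun _ => false

variable {K}

theorem baseLabel_eq {p r : X} {e : Fin (K.dimAt p) ↪ Fin (K.dimAt r)} {s : Fin (K.dimAt r) → Bool}
    (h : K.Near p (K.cubeAt r) (K.posAt r) e s) : K.baseLabel p r = s := by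
  have h' : ∃ s e, K.Near p (K.cubeAt r) (K.posAt r) e s := ⟨s, e, h⟩
  obtain ⟨e', he'⟩ := h'.choose_spec
  rw [baseLabel, dif_pos h']
  exact he'.label_unique h

theorem near_refl (p : X) :
    K.Near p (K.cubeAt p) (K.posAt p) (Function.Embedding.refl _) (fun _ => false) :=
  ⟨by rw [faceMap_refl_false, Function.comp_id], fun j => by
    rw [faceMap_refl_false, id_eq, sub_self, abs_zero]; exact K.epsAt_pos _⟩

theorem mem_nearSet_self (p : X) : p ∈ K.nearSet p := ⟨_, _, near_refl p⟩

/-- Points near `p` can be recognized in every cube that contains them. -/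
theorem mem_nearSet_iff {p : X} {m : ℕ} {d : Cube m → X} (hd : d ∈ K.cubes m) (y : Cube m) :
    d y ∈ K.nearSet p ↔ ∃ e s, K.Near p d y e s := by
  obtain ⟨e₁, s₁, h1, h2⟩ := K.exists_faceMap_cubeAt hd y
  constructor
  · rintro ⟨e, s, h⟩
    rw [← h1] at h
    have h' := h.extend
    rw [h2] at h'
    exact ⟨_, _, h'⟩
  · rintro ⟨e, s, h⟩
    obtain ⟨e', s', h', -⟩ := h.restrict h2
    rw [h1] at h'
    exact ⟨e', s', h'⟩

/-- The transport between the base corners of two cubes near `d y` can be computed in `d`. -/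
theorem IsCocycle.transport_baseLabel (hφ : K.IsCocycle φ) {p q : X} {m : ℕ} {d : Cube m → X}
    (hd : d ∈ K.cubes m) {y : Cube m} {e e' s s'} (h : K.Near p d y e s)
    (h' : K.Near q d y e' s') :
    transport φ (K.cubeAt (d y)) (K.baseLabel p (d y)) (K.baseLabel q (d y)) =
      transport φ d s s' := by
  obtain ⟨e₁, s₁, h1, h2⟩ := K.exists_faceMap_cubeAt hd y
  obtain ⟨f, t, k1, k2⟩ := h.restrict h2
  obtain ⟨f', t', k1', k2'⟩ := h'.restrict h2
  rw [k2, k2', ← hφ.transport_comp hd]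
  rw [h1] at k1 k1' ⊢
  rw [baseLabel_eq k1, baseLabel_eq k1']

theorem isOpen_nearSet (p : X) : IsOpen (K.nearSet p) := by
  rw [K.isOpen_iff]
  intro m d hd
  have : d ⁻¹' K.nearSet p = ⋃ e, ⋃ s, {y | K.Near p d y e s} := by
    ext y
    rw [mem_preimage, mem_nearSet_iff hd]
    simp only [mem_iUnion, mem_ofPred_eq]
  rw [this]
  exact isOpen_iUnion fun e => isOpen_iUnion fun s => isOpen_near d e s

theorem IsCocycle.isOpen_transport_eq (hφ : K.IsCocycle φ) (p q : X) (g : Γ) :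
    IsOpen {r | (r ∈ K.nearSet p ∧ r ∈ K.nearSet q) ∧
      transport φ (K.cubeAt r) (K.baseLabel p r) (K.baseLabel q r) = g} := by
  rw [K.isOpen_iff]
  intro m d hd
  have : d ⁻¹' {r | (r ∈ K.nearSet p ∧ r ∈ K.nearSet q) ∧
      transport φ (K.cubeAt r) (K.baseLabel p r) (K.baseLabel q r) = g} =
      ⋃ e, ⋃ s, ⋃ e', ⋃ s', ⋃ _ : transport φ d s s' = g,
        {y | K.Near p d y e s} ∩ {y | K.Near q d y e' s'} := by
    ext y
    simp only [mem_preimage, mem_iUnion, mem_ofPred_eq, mem_inter_iff, mem_nearSet_iff hd]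
    constructor
    · rintro ⟨⟨⟨e, s, h⟩, e', s', h'⟩, hg⟩
      rw [hφ.transport_baseLabel hd h h'] at hg
      exact ⟨e, s, e', s', hg, h, h'⟩
    · rintro ⟨e, s, e', s', hg, h, h'⟩
      rw [hφ.transport_baseLabel hd h h']
      exact ⟨⟨⟨e, s, h⟩, e', s', h'⟩, hg⟩
  rw [this]
  exact isOpen_iUnion fun e => isOpen_iUnion fun s => isOpen_iUnion fun e' => isOpen_iUnion fun s' =>
    isOpen_iUnion fun _ => (isOpen_near d e s).inter (isOpen_near d e' s')

/-- The covering space with fibre `Γ` and holonomy `φ`: over the neighbourhood of `p`, the fibre is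
identified with `Γ` at the first corner of the cube of `p`. -/
noncomputable def IsCocycle.bundleCore [TopologicalSpace Γ] [DiscreteTopology Γ]
    (hφ : K.IsCocycle φ) : FiberBundleCore X X Γ where
  baseSet := K.nearSet
  isOpen_baseSet := isOpen_nearSet
  indexAt := id
  mem_baseSet_at := mem_nearSet_self
  coordChange p q r g := g * transport φ (K.cubeAt r) (K.baseLabel p r) (K.baseLabel q r)
  coordChange_self p r _ g := by rw [transport_self, mul_one]
  continuousOn_coordChange p q := by
    rintro ⟨r, g⟩ ⟨hr, -⟩
    refine ContinuousAt.continuousWithinAt ?_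
    have hc : ContinuousAt (fun a : X × Γ =>
        a.2 * transport φ (K.cubeAt r) (K.baseLabel p r) (K.baseLabel q r)) (r, g) :=
      ((continuous_of_discreteTopology (f := fun g =>
        g * transport φ (K.cubeAt r) (K.baseLabel p r) (K.baseLabel q r))).comp
          continuous_snd).continuousAt
    refine hc.congr ?_
    have := (hφ.isOpen_transport_eq p q _).mem_nhds
      (show r ∈ _ from ⟨hr, rfl⟩)
    filter_upwards [continuous_fst.continuousAt.preimage_mem_nhds this] with a ha
    rw [ha.2]
  coordChange_comp p q t r _ g := by rw [mul_assoc, transport_mul]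

variable (K) in
/-- The complex is a quotient of the disjoint union of its cubes. -/
theorem isQuotientMap : IsQuotientMap
    (fun x : Σ c : Σ n : ℕ, {c : Cube n → X // c ∈ K.cubes n}, Cube c.1 => x.1.2.1 x.2) := by
  refine ⟨isCoinducing_iff.2 fun U => ?_, fun p => ?_⟩
  · rw [K.isOpen_iff, isOpen_sigma_iff]
    exact ⟨fun h n c hc => h ⟨n, c, hc⟩, fun h c => h c.1 c.2.1 c.2.2⟩
  · exact ⟨⟨⟨K.dimAt p, K.cubeAt p, K.cubeAt_mem p⟩, K.posAt p⟩, K.cubeAt_posAt p⟩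

/-- The cube is a quotient of a vector space, by the coordinatewise projection to the unit interval;
so it is locally path connected. -/
theorem exists_retraction_cube (n : ℕ) : ∃ f : (Fin n → ℝ) → Cube n, IsQuotientMap f := by
  refine ⟨fun x i => projIcc 0 1 zero_le_one (x i), ?_⟩
  refine IsQuotientMap.of_inverse (f := fun (x : Cube n) i => (x i : ℝ)) ?_ ?_ ?_
  · exact continuous_pi fun i => continuous_subtype_val.comp (continuous_apply i)
  · exact continuous_pi fun i => continuous_projIcc.comp (continuous_apply i)
  · intro x
    ext i
    simp

instance (n : ℕ) : LocallyPathConnectedSpace (Cube n) :=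
  (exists_retraction_cube n).choose_spec.locallyPathConnectedSpace

theorem locallyPathConnectedSpace {X : Type w} [TopologicalSpace X] (K : CubeComplex X) :
    LocallyPathConnectedSpace X :=
  K.isQuotientMap.locallyPathConnectedSpace

/-- A simply connected cube complex carries a global section of the covering space of
a cocycle. In terms of the values `γ r` at the first corners of the cubes, continuity says that
nearby values differ by parallel transport. -/
theorem IsCocycle.exists_section [SimplyConnectedSpace X] (hφ : K.IsCocycle φ) :
    ∃ γ : X → Γ, ∀ p, ∀ᶠ r in 𝓝 p, r ∈ K.nearSet p ∧
      γ r * transport φ (K.cubeAt r) (K.baseLabel r r) (K.baseLabel p r) = γ p := by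
  let _ : TopologicalSpace Γ := ⊥
  have : DiscreteTopology Γ := ⟨rfl⟩
  have := K.locallyPathConnectedSpace
  let Z := hφ.bundleCore
  have hcov : IsCoveringMap (Bundle.TotalSpace.proj : Bundle.TotalSpace Γ Z.Fiber → X) :=
    FiberBundle.isCoveringMap
  obtain ⟨x₀⟩ : Nonempty X := inferInstance
  obtain ⟨F, ⟨-, hF⟩, -⟩ := hcov.existsUnique_continuousMap_lifts (ContinuousMap.id X) x₀
    ⟨x₀, (1 : Γ)⟩ rfl
  have hF' : ∀ r, ∃ g : Γ, F r = (⟨r, g⟩ : Bundle.TotalSpace Γ Z.Fiber) := by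
    intro r
    have h : (F r).1 = r := congrFun hF r
    generalize F r = a at h
    obtain ⟨b, g⟩ := a
    obtain rfl : b = r := h
    exact ⟨g, rfl⟩
  choose γ hγ using hF'
  refine ⟨γ, fun p => ?_⟩
  have hval : ∀ r, (Z.localTriv p (F r)).2 =
      γ r * transport φ (K.cubeAt r) (K.baseLabel r r) (K.baseLabel p r) := by
    intro r
    rw [hγ r]
    rfl
  have hsrc : F p ∈ (Z.localTriv p).source := by
    rw [(Z.localTriv p).mem_source, hγ p]
    exact mem_nearSet_self p
  have hcont : ContinuousAt (fun r => (Z.localTriv p (F r)).2) p :=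
    continuous_snd.continuousAt.comp
      (((Z.localTriv p).continuousAt hsrc).comp F.continuous.continuousAt)
  have h1 : ∀ᶠ r in 𝓝 p, (Z.localTriv p (F r)).2 = (Z.localTriv p (F p)).2 :=
    hcont.preimage_mem_nhds ((isOpen_discrete {(Z.localTriv p (F p)).2}).mem_nhds rfl)
  filter_upwards [h1, (isOpen_nearSet p).mem_nhds (mem_nearSet_self p)] with r hr hr'
  rw [hval, hval, transport_self, mul_one] at hr
  exact ⟨hr', hr⟩

theorem continuous_cube {m : ℕ} {d : Cube m → X} (hd : d ∈ K.cubes m) : Continuous d :=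
  ⟨fun U hU => (K.isOpen_iff U).1 hU m d hd⟩

/-- The cube of a corner is a vertex, placed at this corner. -/
theorem label_eq_of_corner {p : X} {m : ℕ} {e : Fin (K.dimAt p) ↪ Fin m} {s u : Fin m → Bool}
    (h : faceMap e s (K.posAt p) = corner u) : s = u := by
  ext j
  have hj := congrFun h j
  by_cases hr : j ∈ range e
  · obtain ⟨i, rfl⟩ := hr
    have h1 : reflect (s (e i)) (K.posAt p i) ∈ Ioo (0 : I) 1 :=
      reflect_mem_Ioo.2 (K.posAt_mem p i)
    rw [← faceMap_apply, hj, corner, reflect_mem_Ioo] at h1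
    exact absurd h1.1 (lt_irrefl _)
  · rw [faceMap_of_notMem _ _ _ hr, corner] at hj
    rw [eq_of_abs_reflect_lt (a := s j) (b := u j) (by rw [hj]; simp)]

/-- A cocycle on a simply connected cube complex is the coboundary of a function on the points,
as far as the corners of cubes are concerned. -/
theorem IsCocycle.exists_coboundary [SimplyConnectedSpace X] (hφ : K.IsCocycle φ) :
    ∃ γ : X → Γ, ∀ c ∈ K.cubes 1,
      γ (c (corner fun _ => true)) = γ (c (corner fun _ => false)) * φ c := by
  obtain ⟨γ, hγ⟩ := hφ.exists_section
  refine ⟨γ, fun d hd => ?_⟩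
  choose E S h1 h2 using fun y => K.exists_faceMap_cubeAt hd y
  -- the values of the section along the edge, all transported to its initial vertex
  let θ : Cube 1 → Γ := fun y => γ (d y) * transport φ d (S y) fun _ => false
  have hθ : IsLocallyConstant θ := by
    rw [IsLocallyConstant.iff_eventually_eq]
    intro x
    filter_upwards [(continuous_cube hd).continuousAt.eventually (hγ (d x)),
      (isOpen_near d (E x) (S x)).mem_nhds (near_self (h1 x) (h2 x))] with y hy hy'
    have h3 := hφ.transport_baseLabel hd (near_self (h1 y) (h2 y)) hy'
    change γ (d y) * _ = γ (d x) * _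
    rw [← hy.2, h3, mul_assoc, transport_mul]
  have h := hθ.apply_eq_of_preconnectedSpace (corner fun _ => true) (corner fun _ => false)
  change γ _ * _ = γ _ * _ at h
  rw [label_eq_of_corner (h2 (corner fun _ => true)),
    label_eq_of_corner (h2 (corner fun _ => false)), transport_self, mul_one] at h
  rw [← h, ← hφ.transport_edge hd, mul_assoc, transport_mul, transport_self, mul_one]

/-- The corner of a cube with label `u`, as a vertex of the complex. -/
def cornerVertex {m : ℕ} {d : Cube m → X} (hd : d ∈ K.cubes m) (u : Fin m → Bool) : K.Vertex :=
  ⟨_, corner_mem hd u⟩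

theorem cornerVertex_flipAt (hK : K.NonpositivelyCurved) {m : ℕ} {d : Cube m → X}
    (hd : d ∈ K.cubes m) (u : Fin m → Bool) (i : Fin m) :
    ∃ w, (flagSquareComplex hK).IsPath (cornerVertex hd u) w (cornerVertex hd (flipAt u i)) := by
  refine ⟨[⟨d ∘ edgeMap u i, K.comp_faceMap_mem hd _ _⟩], Subtype.ext ?_, Subtype.ext ?_⟩
  · exact congrArg d (edgeMap_corner_false u i)
  · exact congrArg d (edgeMap_corner_true u i)

/-- The 1-skeleton is connected, because the set of points whose cube has its corners in a given
component of the 1-skeleton is open and closed. -/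
theorem exists_isPath [PreconnectedSpace X] (hK : K.NonpositivelyCurved) (x y : K.Vertex) :
    ∃ w, (flagSquareComplex hK).IsPath x w y := by
  let P : K.Vertex → Prop := fun y => ∃ w, (flagSquareComplex hK).IsPath x w y
  have hP : ∀ {m : ℕ} {d : Cube m → X} (hd : d ∈ K.cubes m) (u v : Fin m → Bool),
      P (cornerVertex hd u) = P (cornerVertex hd v) := by
    intro m d hd u v
    refine eq_of_flipAt_eq (fun u => P (cornerVertex hd u)) (fun u i => propext ⟨?_, ?_⟩) u v
    · rintro ⟨w, hw⟩
      obtain ⟨w', hw'⟩ := cornerVertex_flipAt hK hd (flipAt u i) i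
      rw [flipAt_flipAt] at hw'
      exact ⟨_, hw.append hw'⟩
    · rintro ⟨w, hw⟩
      obtain ⟨w', hw'⟩ := cornerVertex_flipAt hK hd u i
      exact ⟨_, hw.append hw'⟩
  let b : X → K.Vertex := fun p => cornerVertex (K.cubeAt_mem p) fun _ => false
  have hb : ∀ {m : ℕ} {d : Cube m → X} (hd : d ∈ K.cubes m) (z : Cube m),
      P (b (d z)) = P (cornerVertex hd fun _ => false) := by
    intro m d hd z
    obtain ⟨e, s, h1, h2⟩ := K.exists_faceMap_cubeAt hd z
    rw [hP hd _ s]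
    congr 1
    refine Subtype.ext ?_
    change K.cubeAt (d z) (corner fun _ => false) = d (corner s)
    rw [← h1, Function.comp_apply, faceMap_corner, faceLabel_false]
  have hbv : ∀ v : K.Vertex, P (b v.1) = P v := fun v => hb v.2 default
  have hopen : ∀ Q : Prop → Prop, IsOpen {p | Q (P (b p))} := by
    intro Q
    rw [K.isOpen_iff]
    intro m d hd
    have : d ⁻¹' {p | Q (P (b p))} = {_z | Q (P (cornerVertex hd fun _ => false))} := by
      ext z
      simp only [mem_preimage, mem_ofPred_eq, hb hd z]
    rw [this]
    exact isOpen_const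
  have hclopen : IsClopen {p | P (b p)} := ⟨⟨hopen Not⟩, hopen id⟩
  have huniv := hclopen.eq_univ ⟨x.1, by rw [mem_ofPred_eq, hbv]; exact ⟨[], rfl⟩⟩
  have : y.1 ∈ {p | P (b p)} := huniv ▸ mem_univ _
  rw [mem_ofPred_eq, hbv] at this
  exact this

open Classical in
/-- The square complex of a CAT(0) cube complex is simply connected in the combinatorial sense. -/
theorem IsCAT0.simplyConn (hK : K.IsCAT0) :
    (flagSquareComplex hK.nonpositivelyCurved).SimplyConn where
  conn := by
    have := hK.simplyConnected
    exact exists_isPath hK.nonpositivelyCurved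
  hol Γ _ φ h1 h2 := by
    have := hK.simplyConnected
    let φ' : (Cube 1 → X) → Γ := fun c => if h : c ∈ K.cubes 1 then φ ⟨c, h⟩ else 1
    have hφ' : ∀ e : K.Edge, φ' e.1 = φ e := fun e => dif_pos e.2
    have hc : K.IsCocycle φ' := by
      refine ⟨fun c hc => ?_, fun {a b a' b'} h => ?_⟩
      · exact (hφ' ((flagSquareComplex hK.nonpositivelyCurved).inv ⟨c, hc⟩)).trans
          ((h1 ⟨c, hc⟩).trans (congrArg Inv.inv (hφ' ⟨c, hc⟩).symm))
      · obtain ⟨s, hs, rfl, rfl, rfl, rfl⟩ := id h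
        have := h2 ⟨_, K.comp_faceMap_mem hs _ _⟩ ⟨_, K.comp_faceMap_mem hs _ _⟩
          ⟨_, K.comp_faceMap_mem hs _ _⟩ ⟨_, K.comp_faceMap_mem hs _ _⟩ h
        simp only [← hφ'] at this
        exact this
    obtain ⟨γ, hγ⟩ := hc.exists_coboundary
    exact ⟨fun v => γ v.1, fun e => (hγ e.1 e.2).trans (congrArg _ (hφ' e))⟩

end CubeComplex

/-! ### Weights of walls -/

namespace FlagSquareComplex.SimplyConn

variable {V : Type*} {E : Type w} {C : FlagSquareComplex V E} (hC : C.SimplyConn)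

/-- The walls whose halfspaces at `x` are contained in the halfspace at `x` of the
wall `h`. -/
def below (x : V) (h : C.Wall) : Set C.Wall := {k | hC.half x k ⊆ hC.half x h}

/-- The weight of a wall seen from `x`: the number of walls that shield it from `x`, and
the wall itself. -/
noncomputable def weight (x : V) (h : C.Wall) : ℕ := (hC.below x h).ncard

theorem mem_below_self (x : V) (h : C.Wall) : h ∈ hC.below x h :=
  show hC.half x h ⊆ hC.half x h from Subset.rfl

theorem below_subset {x x₀ : V} {h : C.Wall} (hh : h ∈ hC.sep x x₀) :
    hC.below x h ⊆ hC.sep x x₀ := fun _ hk => hC.mem_sep_of_half_subset hh hk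

theorem finite_below {x x₀ : V} {h : C.Wall} (hh : h ∈ hC.sep x x₀) : (hC.below x h).Finite :=
  (hC.finite_sep x x₀).subset (hC.below_subset hh)

theorem weight_pos {x x₀ : V} {h : C.Wall} (hh : h ∈ hC.sep x x₀) : 0 < hC.weight x h :=
  (Set.ncard_pos (hC.finite_below hh)).2 ⟨h, hC.mem_below_self x h⟩

/-- Walls of the same weight have incomparable halfspaces, so there are boundedly many of them. -/
theorem card_weight_eq_le {N : ℕ} (hfin : ∀ v, {e | C.src e = v}.Finite)
    (hN : ∀ v, {e | C.src e = v}.ncard ≤ N) {x x₀ : V} (A : Finset C.Wall)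
    (hA : ∀ h ∈ A, h ∈ hC.sep x x₀) (n : ℕ) (hn : ∀ h ∈ A, hC.weight x h = n) : A.card ≤ N := by
  refine hC.card_antichain_le hfin hN A hA fun h hh k hk hhk => ?_
  have h1 : hC.below x h ⊆ hC.below x k := fun j hj => Subset.trans hj hhk
  have h2 := Set.eq_of_subset_of_ncard_le h1
    (by rw [← weight, ← weight, hn h hh, hn k hk]) (hC.finite_below (hA k hk))
  have h3 : k ∈ hC.below x h := h2 ▸ hC.mem_below_self x k
  exact hC.half_injective (hhk.antisymm h3)

/-- No wall shields the wall of an edge from the ends of this edge. -/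
theorem weight_wall {e : E} : hC.weight (C.src e) (C.wall e) = 1 := by
  rw [weight, Set.ncard_eq_one]
  refine ⟨C.wall e, Set.eq_singleton_iff_unique_mem.2 ⟨hC.mem_below_self _ _, fun k hk => ?_⟩⟩
  by_contra hne
  have h1 : C.tgt e ∈ hC.half (C.src e) k := hC.side_tgt hne
  exact hC.side_tgt_ne e (hk h1)

/-- Moving across an edge changes the weights of the other walls by at most one. -/
theorem weight_tgt_le {e : E} {h : C.Wall} (hne : h ≠ C.wall e) {x₀ : V}
    (hh : h ∈ hC.sep (C.src e) x₀) :
    hC.weight (C.tgt e) h ≤ hC.weight (C.src e) h + 1 := by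
  refine (Set.ncard_le_ncard (t := insert (C.wall e) (hC.below (C.src e) h)) (fun k hk => ?_)
    ((hC.finite_below hh).insert _)).trans (Set.ncard_insert_le _ _)
  by_cases hke : k = C.wall e
  · exact Or.inl hke
  · right
    rw [below, mem_ofPred_eq, hC.half_tgt hne, hC.half_tgt hke] at hk
    exact hk

theorem weight_src_le {e : E} {h : C.Wall} (hne : h ≠ C.wall e) {x₀ : V}
    (hh : h ∈ hC.sep (C.src e) x₀) :
    hC.weight (C.src e) h ≤ hC.weight (C.tgt e) h + 1 := by
  have h1 := hC.weight_tgt_le (e := C.inv e) (h := h) (by rwa [wall_inv]) (x₀ := x₀)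
    (by rw [C.src_inv]; exact hC.mem_sep_tgt.2 (Or.inl ⟨hne, hh⟩))
  rwa [C.src_inv, C.tgt_inv] at h1

/-- The coordinates of the embedding of the vertices into a Hilbert space: a wall between `x` and the
base point `x₀` contributes a power of its weight seen from `x`. -/
noncomputable def coord (x₀ : V) (ε : ℝ) (x : V) (h : C.Wall) : ℝ :=
  open Classical in if h ∈ hC.sep x x₀ then (hC.weight x h : ℝ) ^ ε else 0

theorem coord_of_mem {x₀ x : V} {ε : ℝ} {h : C.Wall} (hh : h ∈ hC.sep x x₀) :
    hC.coord x₀ ε x h = (hC.weight x h : ℝ) ^ ε := if_pos hh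

theorem coord_of_notMem {x₀ x : V} {ε : ℝ} {h : C.Wall} (hh : h ∉ hC.sep x x₀) :
    hC.coord x₀ ε x h = 0 := if_neg hh

end FlagSquareComplex.SimplyConn

/-! ### Estimates for sums of powers -/

theorem rpow_add_one_sub_rpow_le {a ε : ℝ} (ha : 0 < a) (h0 : 0 ≤ ε) (h1 : ε ≤ 1) :
    (a + 1) ^ ε - a ^ ε ≤ a ^ (ε - 1) := by
  have h2 := rpow_one_add_le_one_add_mul_self (s := 1 / a) (p := ε)
    (by have : 0 < 1 / a := by positivity
        linarith) h0 h1
  have h3 : (a + 1) ^ ε = a ^ ε * (1 + 1 / a) ^ ε := by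
    rw [← Real.mul_rpow ha.le (by positivity)]
    congr 1
    field_simp
  have h4 : a ^ (ε - 1) = a ^ ε * (1 / a) := by
    rw [Real.rpow_sub_one ha.ne']
    ring
  rw [h3, h4]
  have h5 : 0 < a ^ ε := Real.rpow_pos_of_pos ha _
  have h6 : ε * (1 / a) ≤ 1 / a := mul_le_of_le_one_left (by positivity) h1
  nlinarith

/-- The increments of `t ^ ε` are bounded by a multiple of its derivative; the factor `4` allows
for an increment to the left of `a`. -/
theorem sq_rpow_sub_rpow_le {a b : ℕ} (ha : 0 < a) (hb : 0 < b) (hab : a ≤ b + 1) (hba : b ≤ a + 1)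
    {ε : ℝ} (h0 : 0 ≤ ε) (h1 : ε ≤ 1) :
    ((a : ℝ) ^ ε - (b : ℝ) ^ ε) ^ 2 ≤ 4 * (a : ℝ) ^ (2 * ε - 2) := by
  have ha' : (0 : ℝ) < a := by exact_mod_cast ha
  have hb' : (0 : ℝ) < b := by exact_mod_cast hb
  have key : |(a : ℝ) ^ ε - (b : ℝ) ^ ε| ≤ 2 * (a : ℝ) ^ (ε - 1) := by
    have hpos : 0 < (a : ℝ) ^ (ε - 1) := Real.rpow_pos_of_pos ha' _
    rcases lt_trichotomy a b with h | h | h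
    · obtain rfl : b = a + 1 := by omega
      have h2 := rpow_add_one_sub_rpow_le ha' h0 h1
      have h3 : (a : ℝ) ^ ε ≤ ((a : ℝ) + 1) ^ ε := Real.rpow_le_rpow ha'.le (by linarith) h0
      push_cast
      rw [abs_sub_comm, abs_of_nonneg (by linarith)]
      linarith
    · subst h
      simp only [sub_self, abs_zero]
      positivity
    · obtain rfl : a = b + 1 := by omega
      have h2 := rpow_add_one_sub_rpow_le hb' h0 h1
      have h3 : (b : ℝ) ^ ε ≤ ((b : ℝ) + 1) ^ ε := Real.rpow_le_rpow hb'.le (by linarith) h0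
      push_cast
      rw [abs_of_nonneg (by linarith)]
      refine h2.trans ?_
      have h4 : (b : ℝ) ^ (ε - 1) ≤ (((b : ℝ) + 1) / 2) ^ (ε - 1) := by
        refine Real.rpow_le_rpow_of_nonpos (by positivity) ?_ (by linarith)
        have : (1 : ℝ) ≤ b := by exact_mod_cast hb
        linarith
      refine h4.trans ?_
      rw [Real.div_rpow (by positivity) (by norm_num), div_eq_mul_inv, mul_comm,
        ← Real.rpow_neg (by norm_num)]
      refine mul_le_mul_of_nonneg_right ?_ (by positivity)
      calc (2 : ℝ) ^ (-(ε - 1)) ≤ 2 ^ (1 : ℝ) :=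
            Real.rpow_le_rpow_of_exponent_le (by norm_num) (by linarith)
        _ = 2 := by norm_num
  calc ((a : ℝ) ^ ε - (b : ℝ) ^ ε) ^ 2 = |(a : ℝ) ^ ε - (b : ℝ) ^ ε| ^ 2 := (sq_abs _).symm
    _ ≤ (2 * (a : ℝ) ^ (ε - 1)) ^ 2 := pow_le_pow_left₀ (abs_nonneg _) key 2
    _ = 4 * (a : ℝ) ^ (2 * ε - 2) := by
      rw [mul_pow, ← Real.rpow_natCast, ← Real.rpow_natCast, ← Real.rpow_mul ha'.le]
      norm_num
      congr 2
      ring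

/-- A sum over a set on which `f` takes every value at most `N` times. -/
theorem sum_le_mul_tsum {α : Type*} {S : Finset α} {f : α → ℕ} {N : ℕ}
    (hN : ∀ n, (S.filter fun a => f a = n).card ≤ N) {g : ℕ → ℝ} (hg : ∀ n, 0 ≤ g n)
    (hs : Summable g) : ∑ a ∈ S, g (f a) ≤ N * ∑' n, g n := by
  rw [Finset.sum_comp g f]
  calc ∑ n ∈ S.image f, (S.filter fun a => f a = n).card • g n
      ≤ ∑ n ∈ S.image f, N * g n := by
        refine Finset.sum_le_sum fun n _ => ?_
        rw [nsmul_eq_mul]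
        exact mul_le_mul_of_nonneg_right (by exact_mod_cast hN n) (hg n)
    _ = N * ∑ n ∈ S.image f, g n := by rw [Finset.mul_sum]
    _ ≤ N * ∑' n, g n :=
        mul_le_mul_of_nonneg_left (hs.sum_le_tsum _ fun n _ => hg n) (Nat.cast_nonneg N)

/-- If `f` takes every value at most `N` times and no value `0` on a set with at least `n / 2`
elements, then it is larger than `n / (4 * N)` on at least `n / 4` elements. -/
theorem le_sum_rpow {α : Type*} {S : Finset α} {f : α → ℕ} {N : ℕ}
    (hN : ∀ n, (S.filter fun a => f a = n).card ≤ N) (hf : ∀ a ∈ S, 0 < f a) {n : ℕ}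
    (hn : n ≤ 2 * S.card) {p : ℝ} (hp : 0 ≤ p) :
    (n / 4 : ℝ) * (n / (4 * N) : ℝ) ^ p ≤ ∑ a ∈ S, (f a : ℝ) ^ p := by
  classical
  set t : ℝ := n / (4 * N) with ht
  have ht0 : 0 ≤ t := by positivity
  let T := S.filter fun a => (f a : ℝ) ≤ t
  have hT : (T.card : ℝ) ≤ n / 4 := by
    have h1 : T.card ≤ N * (Finset.Icc 1 ⌊t⌋₊).card := by
      refine Finset.card_le_mul_card_image_of_maps_to (f := f) (fun a ha => ?_) N fun b _ => ?_
      · rw [Finset.mem_filter] at ha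
        rw [Finset.mem_Icc]
        exact ⟨hf a ha.1, Nat.le_floor ha.2⟩
      · refine (Finset.card_le_card ?_).trans (hN b)
        exact Finset.filter_subset_filter _ (Finset.filter_subset _ _)
    rw [Nat.card_Icc, Nat.add_sub_cancel] at h1
    have h2 : (T.card : ℝ) ≤ N * ⌊t⌋₊ := by exact_mod_cast h1
    have h3 : (N : ℝ) * ⌊t⌋₊ ≤ N * t :=
      mul_le_mul_of_nonneg_left (Nat.floor_le ht0) (Nat.cast_nonneg N)
    refine h2.trans (h3.trans ?_)
    rcases Nat.eq_zero_or_pos N with rfl | hNpos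
    · rw [Nat.cast_zero, zero_mul]
      positivity
    · have : (0 : ℝ) < N := by exact_mod_cast hNpos
      rw [ht]
      apply le_of_eq
      field_simp
  have hcard : (n / 4 : ℝ) ≤ ((S \ T).card : ℝ) := by
    have h1 : (S \ T).card + T.card = S.card :=
      Finset.card_sdiff_add_card_eq_card (Finset.filter_subset _ _)
    have h2 : ((S \ T).card : ℝ) + T.card = S.card := by exact_mod_cast h1
    have h3 : (n : ℝ) ≤ 2 * S.card := by exact_mod_cast hn
    linarith
  calc (n / 4 : ℝ) * t ^ p ≤ ((S \ T).card : ℝ) * t ^ p :=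
        mul_le_mul_of_nonneg_right hcard (by positivity)
    _ = ∑ a ∈ S \ T, t ^ p := by rw [Finset.sum_const, nsmul_eq_mul]
    _ ≤ ∑ a ∈ S \ T, (f a : ℝ) ^ p := by
        refine Finset.sum_le_sum fun a ha => Real.rpow_le_rpow ht0 ?_ hp
        rw [Finset.mem_sdiff, Finset.mem_filter] at ha
        exact (not_le.1 fun h => ha.2 ⟨ha.1, h⟩).le
    _ ≤ ∑ a ∈ S, (f a : ℝ) ^ p :=
        Finset.sum_le_sum_of_subset_of_nonneg Finset.sdiff_subset fun a _ _ => by positivity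

/-- Finitely supported functions on a countable set as vectors in a Hilbert space, in an
arbitrary universe. -/
theorem exists_hilbert_map {W : Type*} [Countable W] {V : Type*} (F : V → W → ℝ)
    (hF : ∀ x, (Function.support (F x)).Finite) :
    ∃ (H : Type v) (_ : NormedAddCommGroup H) (_ : InnerProductSpace ℝ H) (_ : CompleteSpace H)
      (f : V → H), ∀ x y (S : Finset W), (∀ h, h ∉ S → F x h = F y h) →
        dist (f x) (f y) ^ 2 = ∑ h ∈ S, (F x h - F y h) ^ 2 := by
  classical
  obtain ⟨j, hj⟩ := exists_injective_nat W
  let e : ULift.{v} (range j) ≃ W := Equiv.ulift.trans (Equiv.ofInjective j hj).symm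
  have hmem : ∀ x, Memℓp (fun i => F x (e i)) 2 := by
    intro x
    refine memℓp_gen (summable_of_hasFiniteSupport ?_)
    refine ((hF x).preimage e.injective.injOn).subset fun i hi => ?_
    rw [mem_preimage, Function.mem_support]
    intro h
    apply hi
    simp [h]
  refine ⟨lp (fun _ : ULift.{v} (range j) => ℝ) 2, inferInstance, inferInstance, inferInstance,
    fun x => ⟨fun i => F x (e i), hmem x⟩, fun x y S hS => ?_⟩
  rw [dist_eq_norm, ← Real.rpow_natCast]
  have h := lp.norm_rpow_eq_tsum (p := 2) (by norm_num)
    ((⟨fun i => F x (e i), hmem x⟩ : lp (fun _ : ULift.{v} (range j) => ℝ) 2) -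
      ⟨fun i => F y (e i), hmem y⟩)
  simp only [ENNReal.toReal_ofNat] at h
  rw [Nat.cast_ofNat, h]
  have h2 : ∀ i, ‖((⟨fun i => F x (e i), hmem x⟩ : lp (fun _ : ULift.{v} (range j) => ℝ) 2) -
      ⟨fun i => F y (e i), hmem y⟩ : lp (fun _ : ULift.{v} (range j) => ℝ) 2) i‖ ^ (2 : ℝ) =
      (fun h => (F x h - F y h) ^ 2) (e i) := by
    intro i
    rw [lp.coeFn_sub, Pi.sub_apply, Real.rpow_ofNat, Real.norm_eq_abs, sq_abs]
  rw [tsum_congr h2, e.tsum_eq (fun h => (F x h - F y h) ^ 2)]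
  exact tsum_eq_sum fun h hh => by rw [hS h hh]; simp

/-! ### The embedding of the vertices -/

namespace FlagSquareComplex.SimplyConn

variable {V : Type*} {E : Type w} {C : FlagSquareComplex V E} (hC : C.SimplyConn)

/-- The images of the ends of an edge that crosses a wall towards `x₀` are at bounded distance: a
weight `n` occurs at most `N` times and contributes at most `4 * n ^ (2 * ε - 2)`, which
is summable since `ε < 1 / 2`. -/
theorem sum_sq_coord_le {N : ℕ} (hfin : ∀ v, {e | C.src e = v}.Finite)
    (hN : ∀ v, {e | C.src e = v}.ncard ≤ N) {ε : ℝ} (h0 : 0 ≤ ε) (h1 : ε < 1 / 2) {x₀ : V} {e : E}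
    (he : C.wall e ∈ hC.sep (C.src e) x₀) :
    ∑ h ∈ (hC.finite_sep (C.src e) x₀).toFinset,
      (hC.coord x₀ ε (C.src e) h - hC.coord x₀ ε (C.tgt e) h) ^ 2 ≤
        1 + N * ∑' n : ℕ, 4 * (n : ℝ) ^ (2 * ε - 2) := by
  classical
  have hmem : C.wall e ∈ (hC.finite_sep (C.src e) x₀).toFinset := by simpa using he
  rw [← Finset.add_sum_erase _ _ hmem]
  refine add_le_add ?_ ?_
  · have h2 : C.wall e ∉ hC.sep (C.tgt e) x₀ := by
      rw [hC.sep_tgt he]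
      exact fun h => h.2 rfl
    rw [hC.coord_of_mem he, hC.coord_of_notMem h2, hC.weight_wall]
    simp
  · have hs : Summable fun n : ℕ => 4 * (n : ℝ) ^ (2 * ε - 2) :=
      (Real.summable_nat_rpow.2 (by linarith)).mul_left 4
    refine le_trans (Finset.sum_le_sum (g := fun h =>
      4 * (hC.weight (C.src e) h : ℝ) ^ (2 * ε - 2)) fun h hh => ?_)
      (sum_le_mul_tsum (f := hC.weight (C.src e)) (fun n => ?_) (fun n => by positivity) hs)
    · rw [Finset.mem_erase, Set.Finite.mem_toFinset] at hh
      have hy : h ∈ hC.sep (C.tgt e) x₀ := hC.mem_sep_tgt.2 (Or.inl hh)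
      rw [hC.coord_of_mem hh.2, hC.coord_of_mem hy]
      exact sq_rpow_sub_rpow_le (hC.weight_pos hh.2) (hC.weight_pos hy)
        (hC.weight_src_le hh.1 hh.2) (hC.weight_tgt_le hh.1 hh.2) h0 (by linarith)
    · refine hC.card_weight_eq_le hfin hN (x := C.src e) (x₀ := x₀) _ (fun h hh => ?_) n (fun h hh => ?_)
      · simp only [Finset.mem_filter, Finset.mem_erase, Set.Finite.mem_toFinset] at hh
        exact hh.1.2
      · exact (Finset.mem_filter.1 hh).2

/-- If half of the walls between `x` and `y` also separate `x` from `x₀`, then the coordinates of `y`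
vanish at these walls, and the weights seen from `x` alone keep the images apart. -/
theorem le_sum_sq_coord {N : ℕ} (hfin : ∀ v, {e | C.src e = v}.Finite)
    (hN : ∀ v, {e | C.src e = v}.ncard ≤ N) {ε : ℝ} (h0 : 0 ≤ ε) {x₀ x y : V} {n : ℕ}
    {S : Finset C.Wall} (hS : ∀ h ∈ hC.sep x x₀, h ∈ S)
    (hn : n ≤ 2 * (hC.sep x y ∩ hC.sep x x₀).ncard) :
    (n / 4 : ℝ) * (n / (4 * N) : ℝ) ^ (2 * ε) ≤
      ∑ h ∈ S, (hC.coord x₀ ε x h - hC.coord x₀ ε y h) ^ 2 := by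
  classical
  have hf : (hC.sep x y ∩ hC.sep x x₀).Finite := (hC.finite_sep x y).inter_of_left _
  have h1 := le_sum_rpow (S := hf.toFinset) (f := hC.weight x) (N := N) (n := n) (p := 2 * ε)
    (fun k => by
      refine hC.card_weight_eq_le hfin hN (x := x) (x₀ := x₀) _ (fun h hh => ?_) k (fun h hh => ?_)
      · simp only [Finset.mem_filter, Set.Finite.mem_toFinset] at hh
        exact hh.1.2
      · exact (Finset.mem_filter.1 hh).2)
    (fun h hh => hC.weight_pos (x₀ := x₀) ((Set.Finite.mem_toFinset _).1 hh).2)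
    (by rwa [← Set.ncard_eq_toFinset_card _ hf]) (by linarith)
  refine h1.trans (le_trans (Finset.sum_le_sum fun h hh => ?_)
    (Finset.sum_le_sum_of_subset_of_nonneg (fun h hh => ?_) fun h _ _ => sq_nonneg _))
  · rw [Set.Finite.mem_toFinset] at hh
    have hy : h ∉ hC.sep y x₀ := by
      intro hy
      exact hh.1 (zmod_two_eq hh.2 hy)
    rw [hC.coord_of_mem hh.2, hC.coord_of_notMem hy, sub_zero, ← Real.rpow_natCast,
      ← Real.rpow_mul (Nat.cast_nonneg _), mul_comm, Nat.cast_ofNat]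
  · exact hS h ((Set.Finite.mem_toFinset _).1 hh).2

/-- The weighted embedding of the vertices into a Hilbert space: it is Lipschitz along edges
and compresses distances at most to the power `ε + 1 / 2`. -/
theorem exists_hilbert_embedding [Countable C.Wall] {N : ℕ} (hN0 : 0 < N)
    (hfin : ∀ v, {e | C.src e = v}.Finite) (hN : ∀ v, {e | C.src e = v}.ncard ≤ N) (x₀ : V)
    {ε : ℝ} (h0 : 0 < ε) (h1 : ε < 1 / 2) :
    ∃ (H : Type v) (_ : NormedAddCommGroup H) (_ : InnerProductSpace ℝ H) (_ : CompleteSpace H)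
      (f : V → H), (∃ L : ℝ, ∀ e, dist (f (C.src e)) (f (C.tgt e)) ≤ L) ∧
        ∃ c : ℝ, 0 < c ∧ ∀ x y, c * ((hC.sep x y).ncard : ℝ) ^ (ε + 1 / 2) ≤ dist (f x) (f y) := by
  classical
  obtain ⟨H, i1, i2, i3, f, hf⟩ := exists_hilbert_map.{v} (hC.coord x₀ ε) (fun x =>
    (hC.finite_sep x x₀).subset fun h hh => by
      by_contra hc
      exact hh (hC.coord_of_notMem hc))
  refine ⟨H, i1, i2, i3, f, ?_, ?_⟩
  · refine ⟨√(1 + N * ∑' n : ℕ, 4 * (n : ℝ) ^ (2 * ε - 2)), fun e => Real.le_sqrt_of_sq_le ?_⟩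
    have key : ∀ e, C.wall e ∈ hC.sep (C.src e) x₀ → dist (f (C.src e)) (f (C.tgt e)) ^ 2 ≤
        1 + N * ∑' n : ℕ, 4 * (n : ℝ) ^ (2 * ε - 2) := by
      intro e he
      rw [hf _ _ (hC.finite_sep (C.src e) x₀).toFinset fun h hh => ?_]
      · exact hC.sum_sq_coord_le hfin hN h0.le h1 he
      · rw [Set.Finite.mem_toFinset] at hh
        have h2 : h ∉ hC.sep (C.tgt e) x₀ := by
          rw [hC.sep_tgt he]
          exact fun h => hh h.1
        rw [hC.coord_of_notMem hh, hC.coord_of_notMem h2]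
    by_cases he : C.wall e ∈ hC.sep (C.src e) x₀
    · exact key e he
    · have h2 := key (C.inv e) (by
        rw [wall_inv, C.src_inv]
        exact hC.mem_sep_tgt.2 (Or.inr ⟨rfl, he⟩))
      rwa [C.src_inv, C.tgt_inv, dist_comm] at h2
  · have hN' : (0 : ℝ) < N := by exact_mod_cast hN0
    refine ⟨√(1 / (4 * (4 * N) ^ (2 * ε))), by positivity, fun x y => ?_⟩
    refine abs_le_of_sq_le_sq' ?_ dist_nonneg |>.2
    set n := (hC.sep x y).ncard with hn
    have hexp : (√(1 / (4 * (4 * N : ℝ) ^ (2 * ε))) * (n : ℝ) ^ (ε + 1 / 2)) ^ 2 =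
        (n / 4 : ℝ) * (n / (4 * N) : ℝ) ^ (2 * ε) := by
      have hn0 : (0 : ℝ) ≤ n := Nat.cast_nonneg n
      rw [mul_pow, Real.sq_sqrt (by positivity), ← Real.rpow_natCast ((n : ℝ) ^ _) 2,
        ← Real.rpow_mul hn0, Real.div_rpow hn0 (by positivity),
        show (ε + 1 / 2) * ((2 : ℕ) : ℝ) = 1 + 2 * ε by push_cast; ring,
        Real.rpow_add_of_nonneg hn0 zero_le_one (by linarith), Real.rpow_one]
      field_simp
    rw [hexp]
    let S := (hC.finite_sep x x₀).toFinset ∪ (hC.finite_sep y x₀).toFinset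
    have hS : ∀ h, h ∈ S ↔ h ∈ hC.sep x x₀ ∨ h ∈ hC.sep y x₀ := by simp [S]
    rw [hf x y S fun h hh => by
      rw [hS, not_or] at hh
      rw [hC.coord_of_notMem hh.1, hC.coord_of_notMem hh.2]]
    -- a wall between `x` and `y` separates exactly one of the two from `x₀`
    have hle : n ≤ (hC.sep x y ∩ hC.sep x x₀).ncard + (hC.sep x y ∩ hC.sep y x₀).ncard := by
      refine (Set.ncard_le_ncard (fun h hh => ?_)
        (((hC.finite_sep x y).inter_of_left _).union ((hC.finite_sep x y).inter_of_left _))).trans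
          (Set.ncard_union_le _ _)
      by_cases hx : h ∈ hC.sep x x₀
      · exact Or.inl ⟨hh, hx⟩
      · refine Or.inr ⟨hh, fun hy => ?_⟩
        rw [mem_sep, not_not] at hx
        exact hh (hx.trans hy.symm)
    rcases le_total (hC.sep x y ∩ hC.sep y x₀).ncard (hC.sep x y ∩ hC.sep x x₀).ncard with h | h
    · exact hC.le_sum_sq_coord hfin hN h0.le (fun h hh => (hS h).2 (Or.inl hh)) (by omega)
    · rw [Finset.sum_congr rfl fun h _ => sub_sq_comm _ _]
      exact hC.le_sum_sq_coord hfin hN h0.le (fun h hh => (hS h).2 (Or.inr hh))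
        (by rw [hC.sep_comm y x]; omega)

end FlagSquareComplex.SimplyConn

/-! ### Midpoints of cubes -/

/-- The midpoint of the standard cube. -/
noncomputable def midCube (n : ℕ) : Cube n := fun _ => ⟨1 / 2, by norm_num, by norm_num⟩

theorem midCube_mem (n : ℕ) : midCube n ∈ cubeInterior n := fun i => by
  constructor
  · change (0 : ℝ) < 1 / 2
    norm_num
  · change (1 / 2 : ℝ) < 1
    norm_num

namespace CubeComplex

variable {X : Type w} [TopologicalSpace X] (K : CubeComplex X)

/-- The midpoints of the `n`-cubes. -/
def midpoints (n : ℕ) : Set X := {p | ∃ c ∈ K.cubes n, c (midCube n) = p}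

/-- A set of midpoints of `n`-cubes is closed, as it has finitely many preimages in every cube. -/
theorem isClosed_of_subset_midpoints {n : ℕ} {A : Set X} (hA : A ⊆ K.midpoints n) :
    IsClosed A := by
  rw [← isOpen_compl_iff, K.isOpen_iff]
  intro m d hd
  rw [preimage_compl, isOpen_compl_iff]
  refine Set.Finite.isClosed (Set.Finite.subset (Set.finite_range
    fun a : (Fin n ↪ Fin m) × (Fin m → Bool) => faceMap a.1 a.2 (midCube n)) fun y hy => ?_)
  obtain ⟨c, hc, h⟩ := hA hy
  obtain ⟨k, e, s, z, hz, rfl⟩ := exists_faceMap_eq y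
  obtain ⟨f, hf, h1, -⟩ := K.eq_comp (K.comp_faceMap_mem hd e s) hc z hz _ (midCube_mem n) h.symm
  obtain ⟨e', s', rfl⟩ := hf.exists_eq
  exact ⟨(e'.trans e, faceLabel e s s'), by
    dsimp only
    rw [← faceMap_comp, Function.comp_apply, h1]⟩

/-- The midpoints of `n`-cubes form a closed discrete set, so a compact set contains finitely many
of them. -/
theorem finite_inter_midpoints (n : ℕ) {A : Set X} (hA : IsCompact A) :
    (A ∩ K.midpoints n).Finite := by
  have hc : IsCompact (A ∩ K.midpoints n) :=
    hA.inter_right (K.isClosed_of_subset_midpoints subset_rfl)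
  have : CompactSpace ↥(A ∩ K.midpoints n) := isCompact_iff_compactSpace.1 hc
  have : DiscreteTopology ↥(A ∩ K.midpoints n) := by
    rw [discreteTopology_iff_isOpen_singleton]
    intro a
    rw [← isClosed_compl_iff]
    have h : IsClosed (Subtype.val '' ({a}ᶜ : Set ↥(A ∩ K.midpoints n))) :=
      K.isClosed_of_subset_midpoints (n := n) (by rintro _ ⟨b, -, rfl⟩; exact b.2.2)
    rw [← preimage_image_eq ({a}ᶜ : Set ↥(A ∩ K.midpoints n)) Subtype.val_injective]
    exact h.preimage continuous_subtype_val
  exact Set.finite_coe_iff.1 finite_of_compact_of_discrete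

/-- Only finitely many parametrized cubes have a given midpoint. -/
theorem finite_midpoint_eq (n : ℕ) (p : X) : {c ∈ K.cubes n | c (midCube n) = p}.Finite := by
  rcases Set.eq_empty_or_nonempty {c ∈ K.cubes n | c (midCube n) = p} with h | ⟨c, hc, rfl⟩
  · rw [h]
    exact Set.finite_empty
  · refine (Set.finite_range fun a : (Fin n ↪ Fin n) × (Fin n → Bool) =>
      c ∘ faceMap a.1 a.2).subset ?_
    rintro d ⟨hd, h⟩
    obtain ⟨f, hf, -, h2⟩ := K.eq_comp hc hd _ (midCube_mem n) _ (midCube_mem n) h.symm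
    obtain ⟨e, s, rfl⟩ := hf.exists_eq
    exact ⟨(e, s), h2.symm⟩

/-! ### Cocompact and proper actions -/

variable {G : Type u} [Group G] [MulAction G X] {K}

/-- A cocompact action has finitely many orbits of `n`-cubes. -/
theorem exists_finite_cubes (hcub : K.IsCubicalAction G) (hco : IsCocompactAction G X) (n : ℕ) :
    ∃ F : Set (Cube n → X), F.Finite ∧ F ⊆ K.cubes n ∧
      ∀ c ∈ K.cubes n, ∃ g : G, ∃ d ∈ F, c = fun x => g • d x := by
  obtain ⟨A, hA, hcov⟩ := hco
  refine ⟨⋃ p ∈ A ∩ K.midpoints n, {c ∈ K.cubes n | c (midCube n) = p},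
    (K.finite_inter_midpoints n hA).biUnion fun p _ => K.finite_midpoint_eq n p, ?_, ?_⟩
  · simp only [iUnion_subset_iff]
    exact fun p _ c hc => hc.1
  · intro c hc
    have h : c (midCube n) ∈ ⋃ g : G, (fun x => g • x) '' A := hcov ▸ mem_univ _
    obtain ⟨g, p, hp, hg⟩ := mem_iUnion.1 h
    have hd : (fun x => g⁻¹ • c x) ∈ K.cubes n := hcub _ _ _ hc
    have hm : (fun x => g⁻¹ • c x) (midCube n) = p := by
      change g⁻¹ • c (midCube n) = p
      rw [← hg, inv_smul_smul]
    refine ⟨g, fun x => g⁻¹ • c x, ?_, by simp⟩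
    simp only [mem_iUnion]
    exact ⟨p, ⟨hp, _, hd, hm⟩, hd, hm⟩

theorem finite_smul_eq [ProperlyDiscontinuousSMul G X] (p q : X) : {g : G | g • p = q}.Finite := by
  refine (ProperlyDiscontinuousSMul.finite_disjoint_inter_image (Γ := G)
    (isCompact_singleton (x := p)) (isCompact_singleton (x := q))).subset fun g hg => ?_
  rw [mem_ofPred_eq] at hg ⊢
  exact ⟨q, ⟨p, rfl, hg⟩, rfl⟩

/-- The action on the vertices. -/
def smulVertex (hcub : K.IsCubicalAction G) (g : G) (x : K.Vertex) : K.Vertex :=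
  ⟨g • x.1, hcub g 0 _ x.2⟩

/-- The action on the oriented edges. -/
def smulEdge (hcub : K.IsCubicalAction G) (g : G) (e : K.Edge) : K.Edge :=
  ⟨fun x => g • e.1 x, hcub g 1 _ e.2⟩

variable (hK : K.NonpositivelyCurved) (hcub : K.IsCubicalAction G)

theorem src_smulEdge (g : G) (e : K.Edge) : (flagSquareComplex hK).src (smulEdge hcub g e) =
    smulVertex hcub g ((flagSquareComplex hK).src e) := rfl

theorem tgt_smulEdge (g : G) (e : K.Edge) : (flagSquareComplex hK).tgt (smulEdge hcub g e) =
    smulVertex hcub g ((flagSquareComplex hK).tgt e) := rfl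

theorem smulVertex_mul (g h : G) (x : K.Vertex) :
    smulVertex hcub (g * h) x = smulVertex hcub g (smulVertex hcub h x) :=
  Subtype.ext (mul_smul _ _ _)

theorem smulVertex_inv_self (g : G) (x : K.Vertex) :
    smulVertex hcub g⁻¹ (smulVertex hcub g x) = x :=
  Subtype.ext (inv_smul_smul _ _)

theorem smulEdge_self_inv (g : G) (e : K.Edge) : smulEdge hcub g (smulEdge hcub g⁻¹ e) = e :=
  Subtype.ext (funext fun _ => smul_inv_smul _ _)

theorem isPath_smul {g : G} {x y : K.Vertex} {w : List K.Edge}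
    (hw : (flagSquareComplex hK).IsPath x w y) :
    (flagSquareComplex hK).IsPath (smulVertex hcub g x) (w.map (smulEdge hcub g))
      (smulVertex hcub g y) := by
  induction w generalizing x with
  | nil => exact congrArg _ hw
  | cons e w ih => exact ⟨congrArg (smulVertex hcub g) hw.1, ih hw.2⟩

theorem exists_finite_vertices (hco : IsCocompactAction G X) :
    ∃ F : Set K.Vertex, F.Finite ∧ ∀ v, ∃ g : G, ∃ u ∈ F, v = smulVertex hcub g u := by
  obtain ⟨F, hF, hFK, h⟩ := exists_finite_cubes hcub hco 0
  refine ⟨(fun v : K.Vertex => fun _ : Cube 0 => v.1) ⁻¹' F,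
    hF.preimage fun v _ v' _ hv => Subtype.ext (congrFun hv default), fun v => ?_⟩
  obtain ⟨g, d, hd, hg⟩ := h _ v.2
  have hdc : (fun _ : Cube 0 => d default) = d := funext fun x => by rw [Subsingleton.elim x default]
  exact ⟨g, ⟨d default, by rw [hdc]; exact hFK hd⟩, by rw [mem_preimage, hdc]; exact hd,
    Subtype.ext (congrFun hg default)⟩

theorem finite_edges_at [ProperlyDiscontinuousSMul G X] (hcub : K.IsCubicalAction G)
    (hco : IsCocompactAction G X) (v : K.Vertex) :
    {e | (flagSquareComplex hK).src e = v}.Finite := by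
  obtain ⟨F, hF, -, h⟩ := exists_finite_cubes hcub hco 1
  have hfin : (⋃ d ∈ F, (fun (g : G) x => g • d x) ''
      {g : G | g • d (corner fun _ => false) = v.1}).Finite :=
    hF.biUnion fun d _ => (finite_smul_eq _ _).image _
  refine (hfin.preimage Subtype.val_injective.injOn).subset fun e he => ?_
  obtain ⟨g, d, hd, hg⟩ := h e.1 e.2
  simp only [mem_preimage, mem_iUnion]
  refine ⟨d, hd, g, ?_, hg.symm⟩
  have := congrArg Subtype.val he
  change e.1 _ = v.1 at this
  rw [hg] at this
  exact this

theorem exists_card_edges_at_le [ProperlyDiscontinuousSMul G X] (hcub : K.IsCubicalAction G)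
    (hco : IsCocompactAction G X) :
    ∃ N, 0 < N ∧ ∀ v, {e | (flagSquareComplex hK).src e = v}.ncard ≤ N := by
  obtain ⟨F, hF, h⟩ := exists_finite_vertices hcub hco
  refine ⟨1 + ∑ u ∈ hF.toFinset, {e | (flagSquareComplex hK).src e = u}.ncard, by omega,
    fun v => ?_⟩
  obtain ⟨g, u, hu, rfl⟩ := h v
  have h1 : {e | (flagSquareComplex hK).src e = u}.ncard ≤
      ∑ u ∈ hF.toFinset, {e | (flagSquareComplex hK).src e = u}.ncard :=
    Finset.single_le_sum (f := fun u => {e | (flagSquareComplex hK).src e = u}.ncard)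
      (fun _ _ => Nat.zero_le _) (hF.mem_toFinset.2 hu)
  have hfin := finite_edges_at hK hcub hco u
  have h2 : {e | (flagSquareComplex hK).src e = smulVertex hcub g u} ⊆
      smulEdge hcub g '' {e | (flagSquareComplex hK).src e = u} := by
    intro e he
    refine ⟨smulEdge hcub g⁻¹ e, ?_, smulEdge_self_inv hcub g e⟩
    rw [mem_ofPred_eq] at he ⊢
    rw [src_smulEdge, he, smulVertex_inv_self]
  have h3 := (Set.ncard_le_ncard h2 (hfin.image _)).trans (Set.ncard_image_le hfin)
  omega

theorem countable_edge [Countable G] (hcub : K.IsCubicalAction G) (hco : IsCocompactAction G X) :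
    Countable K.Edge := by
  obtain ⟨F, hF, -, h⟩ := exists_finite_cubes hcub hco 1
  have hc : (⋃ d ∈ F, range fun (g : G) x => g • d x).Countable :=
    hF.countable.biUnion fun d _ => countable_range _
  refine (hc.mono fun c hc => ?_ : (K.cubes 1).Countable).to_subtype
  obtain ⟨g, d, hd, hg⟩ := h c hc
  simp only [mem_iUnion]
  exact ⟨d, hd, g, hg.symm⟩

end CubeComplex

/-! ### Word metrics -/

section Cayley

variable {G : Type u} [Group G] {S : Set G}

/-- Right multiplication by a fixed element moves points by a bounded distance. -/
theorem exists_dist_mul_le (hS : Subgroup.closure S = ⊤) (t : G) :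
    ∃ M : ℕ, ∀ g, (SimpleGraph.mulCayley S).dist g (g * t) ≤ M := by
  have hcon := mulCayley_connected S hS
  have ht : t ∈ Subgroup.closure S := by rw [hS]; trivial
  induction ht using Subgroup.closure_induction with
  | mem s hs =>
    refine ⟨1, fun g => ?_⟩
    by_cases h : g = g * s
    · rw [← h]
      simp
    · exact (SimpleGraph.dist_eq_one_iff_adj.2
        ((SimpleGraph.mulCayley_adj' S _ _).2 ⟨h, s, hs, Or.inl rfl⟩)).le
  | one => exact ⟨0, by simp⟩
  | mul a b _ _ iha ihb =>
    obtain ⟨M, hM⟩ := iha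
    obtain ⟨M', hM'⟩ := ihb
    refine ⟨M + M', fun g => (hcon.dist_triangle (v := g * a)).trans (add_le_add (hM g) ?_)⟩
    rw [← mul_assoc]
    exact hM' _
  | inv a _ iha =>
    obtain ⟨M, hM⟩ := iha
    refine ⟨M, fun g => ?_⟩
    rw [SimpleGraph.dist_comm]
    simpa using hM (g * a⁻¹)

theorem finite_ball (hS : Subgroup.closure S = ⊤) (hfin : S.Finite) (n : ℕ) :
    {g | (SimpleGraph.mulCayley S).dist 1 g ≤ n}.Finite := by
  have hcon := mulCayley_connected S hS
  induction n with
  | zero =>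
    refine (Set.finite_singleton 1).subset fun g hg => ?_
    exact (hcon.dist_eq_zero_iff.1 (Nat.le_zero.1 hg)).symm
  | succ n ih =>
    refine (ih.union ((Set.Finite.image2 (fun x s => x * s) ih hfin).union
      (Set.Finite.image2 (fun x s => x * s⁻¹) ih hfin))).subset fun g hg => ?_
    rcases Nat.lt_or_ge n ((SimpleGraph.mulCayley S).dist 1 g) with h | h
    · obtain ⟨p, hp⟩ := hcon.exists_walk_length_eq_dist g 1
      rw [SimpleGraph.dist_comm] at hp
      cases p with
      | nil =>
        rw [SimpleGraph.dist_self] at h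
        exact absurd h (Nat.not_lt_zero _)
      | cons hadj q =>
        rename_i x
        rw [SimpleGraph.Walk.length_cons] at hp
        rw [mem_ofPred_eq] at hg
        have hx : (SimpleGraph.mulCayley S).dist 1 x ≤ n := by
          rw [SimpleGraph.dist_comm]
          exact (SimpleGraph.dist_le q).trans (by omega)
        obtain ⟨-, s, hs, h | h⟩ := (SimpleGraph.mulCayley_adj' S _ _).1 hadj
        · exact Or.inr (Or.inr ⟨x, hx, s, hs, by rw [← h]; simp⟩)
        · exact Or.inr (Or.inl ⟨x, hx, s, hs, h.symm⟩)
    · exact Or.inl h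

theorem countable_of_finite_generators (hS : Subgroup.closure S = ⊤) (hfin : S.Finite) :
    Countable G := by
  rw [← Set.countable_univ_iff]
  refine (Set.countable_iUnion fun n => (finite_ball hS hfin n).countable).mono fun g _ => ?_
  exact mem_iUnion.2 ⟨(SimpleGraph.mulCayley S).dist 1 g, le_refl ((SimpleGraph.mulCayley S).dist 1 g)⟩

/-- In an infinite group all distances occur. -/
theorem exists_wordDist_eq [Infinite G] (hS : Subgroup.closure S = ⊤) (hfin : S.Finite) (n : ℕ) :
    ∃ g, (SimpleGraph.mulCayley S).dist 1 g = n := by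
  have hcon := mulCayley_connected S hS
  obtain ⟨y, hy⟩ := (finite_ball hS hfin n).infinite_compl.nonempty
  rw [mem_compl_iff, mem_ofPred_eq, not_le] at hy
  have key : ∀ {x y : G} (p : (SimpleGraph.mulCayley S).Walk x y),
      (SimpleGraph.mulCayley S).dist 1 x ≤ n → n ≤ (SimpleGraph.mulCayley S).dist 1 y →
      ∃ g, (SimpleGraph.mulCayley S).dist 1 g = n := by
    intro x y p
    induction p with
    | nil => exact fun h h' => ⟨_, le_antisymm h h'⟩
    | @cons x z y hadj p ih =>
      intro h h'
      rcases h.eq_or_lt with h | h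
      · exact ⟨x, h⟩
      · refine ih ?_ h'
        have := hcon.dist_triangle (u := 1) (v := x) (w := z)
        rw [SimpleGraph.dist_eq_one_iff_adj.2 hadj] at this
        omega
  obtain ⟨p⟩ := hcon.preconnected 1 y
  exact key p (by simp) hy.le

end Cayley

/-! ### Comparison of the word metric with the number of separating walls -/

namespace CubeComplex

variable {X : Type w} [TopologicalSpace X] {K : CubeComplex X} {G : Type u} [Group G]
  [MulAction G X] {S : Set G}

/-- The orbit of a vertex does not compress the word metric by more than an affine function. -/
theorem exists_dist_le [ProperlyDiscontinuousSMul G X] (hS : Subgroup.closure S = ⊤)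
    (hK : K.NonpositivelyCurved) (hcub : K.IsCubicalAction G) (hco : IsCocompactAction G X)
    (x₀ : K.Vertex) :
    ∃ M : ℕ, ∀ (g h : G) (w : List K.Edge),
      (flagSquareComplex hK).IsPath (smulVertex hcub g x₀) w (smulVertex hcub h x₀) →
      (SimpleGraph.mulCayley S).dist g h ≤ M * (w.length + 1) := by
  have hcon := mulCayley_connected S hS
  obtain ⟨F₀, hF₀, hcov⟩ := exists_finite_vertices hcub hco
  let F := insert x₀ F₀
  have hF : F.Finite := hF₀.insert x₀
  -- the group elements that relate points of `F` to points of `F` or to their neighbours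
  let T : Set G := ⋃ u ∈ F, ⋃ u' ∈ F, {t | smulVertex hcub t u' = u} ∪
    ⋃ e ∈ {e | (flagSquareComplex hK).src e = u},
      {t | smulVertex hcub t u' = (flagSquareComplex hK).tgt e}
  have hfin : ∀ a b : K.Vertex, {t : G | smulVertex hcub t a = b}.Finite := fun a b =>
    (finite_smul_eq a.1 b.1).subset fun t ht => congrArg Subtype.val ht
  have hT : T.Finite := hF.biUnion fun u _ => hF.biUnion fun u' _ => (hfin _ _).union
    ((finite_edges_at hK hcub hco u).biUnion fun e _ => hfin _ _)
  choose M hM using exists_dist_mul_le hS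
  have hMT : ∀ t ∈ T, ∀ g, (SimpleGraph.mulCayley S).dist g (g * t) ≤ hT.toFinset.sup M :=
    fun t ht g => (hM t g).trans (Finset.le_sup (hT.mem_toFinset.2 ht))
  have hMT' : ∀ g h, g⁻¹ * h ∈ T → (SimpleGraph.mulCayley S).dist g h ≤ hT.toFinset.sup M :=
    fun g h ht => by simpa using hMT _ ht g
  refine ⟨hT.toFinset.sup M, fun g h w hw => ?_⟩
  suffices key : ∀ (w : List K.Edge) (g : G) (u : K.Vertex), u ∈ F →
      (flagSquareComplex hK).IsPath (smulVertex hcub g u) w (smulVertex hcub h x₀) →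
      (SimpleGraph.mulCayley S).dist g h ≤ hT.toFinset.sup M * (w.length + 1) from
    key w g x₀ (mem_insert _ _) hw
  clear hw w g
  intro w
  induction w with
  | nil =>
    intro g u hu hw
    rw [List.length_nil, zero_add, mul_one]
    refine hMT' g h ?_
    simp only [T, mem_iUnion]
    refine ⟨u, hu, x₀, mem_insert _ _, Or.inl ?_⟩
    rw [mem_ofPred_eq, smulVertex_mul, ← (show _ = _ from hw), smulVertex_inv_self]
  | cons e w ih =>
    intro g u hu hw
    obtain ⟨k, u', hu', hk⟩ := hcov ((flagSquareComplex hK).tgt e)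
    have hu'F : u' ∈ F := mem_insert_of_mem _ hu'
    have h1 := ih k u' hu'F (hk ▸ hw.2)
    have h2 : (SimpleGraph.mulCayley S).dist g k ≤ hT.toFinset.sup M := by
      refine hMT' g k ?_
      simp only [T, mem_iUnion]
      refine ⟨u, hu, u', hu'F, Or.inr ?_⟩
      simp only [mem_iUnion]
      refine ⟨smulEdge hcub g⁻¹ e, ?_, ?_⟩
      · rw [mem_ofPred_eq, src_smulEdge, hw.1, smulVertex_inv_self]
      · rw [mem_ofPred_eq, tgt_smulEdge, hk, smulVertex_mul]
    calc _ ≤ _ := hcon.dist_triangle (v := k)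
      _ ≤ _ := add_le_add h2 h1
      _ = _ := by rw [List.length_cons]; ring

end CubeComplex

/-! ### Estimates for the asymptotic compression -/

/-- A multiple of the power `r ^ α` has growth exponent `α`. -/
theorem tendsto_log_mul_rpow_div_log {c : ℝ} (hc : 0 < c) (α : ℝ) :
    Tendsto (fun r : ℝ => ((Real.log (c * r ^ α) / Real.log r : ℝ) : EReal)) atTop
      (𝓝 (α : EReal)) := by
  refine (continuous_coe_real_ereal.tendsto α).comp ?_
  have h1 : Tendsto (fun r : ℝ => Real.log c / Real.log r + α) atTop (𝓝 (0 + α)) :=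
    (tendsto_const_nhds.div_atTop Real.tendsto_log_atTop).add_const α
  rw [zero_add] at h1
  refine h1.congr' ?_
  filter_upwards [eventually_gt_atTop 1] with r hr
  have hr0 : 0 < r := zero_lt_one.trans hr
  have hl : Real.log r ≠ 0 := (Real.log_pos hr).ne'
  rw [Real.log_mul hc.ne' (Real.rpow_pos_of_pos hr0 _).ne', Real.log_rpow hr0]
  field_simp

section Compression

variable {A : Type u} {B : Type v} [MetricSpace A] [MetricSpace B] {f : A → B}

/-- On a space in which all natural numbers occur as distances, a large-scale Lipschitz map has
compression function of at most linear growth. -/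
theorem asymptoticCompression_le_one (hA : ∀ n : ℕ, ∃ x y : A, dist x y = n)
    (hf : LargeScaleLipschitz f) : asymptoticCompression f ≤ 1 := by
  obtain ⟨C, D, hC, hD, hf⟩ := hf
  -- for `1 < r` there are points at distance between `r` and `r + 1 < 2 * r`
  have hc : 0 < 2 * C + D + 1 := by positivity
  have h := (tendsto_log_mul_rpow_div_log hc 1).liminf_eq
  rw [EReal.coe_one] at h
  rw [← h]
  refine liminf_le_liminf ?_
  filter_upwards [eventually_gt_atTop 1] with r hr
  rw [EReal.coe_le_coe_iff]
  refine div_le_div_of_nonneg_right (Real.log_le_log (by positivity) ?_) (Real.log_pos hr).le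
  rw [Real.rpow_one]
  obtain ⟨x, y, hxy⟩ := hA ⌈r⌉₊
  have h1 : r ≤ dist x y := hxy ▸ Nat.le_ceil r
  have h2 : dist x y ≤ r + 1 := hxy ▸ (Nat.ceil_lt_add_one (by linarith)).le
  have h3 : compressionFun f r ≤ dist (f x) (f y) :=
    csInf_le ⟨0, by rintro _ ⟨a, b, -, rfl⟩; exact dist_nonneg⟩ ⟨x, y, h1, rfl⟩
  have h4 := hf x y
  refine max_le ?_ ?_ <;> nlinarith

/-- A map that does not compress large distances below a multiple of their power `α` has
asymptotic compression at least `α`. -/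
theorem le_asymptoticCompression {c α r₀ : ℝ} (hc : 0 < c) (hα : 0 ≤ α)
    (hA : ∀ n : ℕ, ∃ x y : A, dist x y = n)
    (hf : ∀ x y, r₀ ≤ dist x y → c * dist x y ^ α ≤ dist (f x) (f y)) :
    (α : EReal) ≤ asymptoticCompression f := by
  rw [← (tendsto_log_mul_rpow_div_log hc α).liminf_eq]
  refine liminf_le_liminf ?_
  filter_upwards [eventually_gt_atTop 1, eventually_ge_atTop r₀] with r hr hr₀
  rw [EReal.coe_le_coe_iff]
  have hr0 : 0 < r := zero_lt_one.trans hr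
  refine div_le_div_of_nonneg_right (Real.log_le_log
    (mul_pos hc (Real.rpow_pos_of_pos hr0 _)) (le_trans ?_ (le_max_left _ _))) (Real.log_pos hr).le
  obtain ⟨x, y, hxy⟩ := hA ⌈r⌉₊
  refine le_csInf ⟨_, x, y, hxy ▸ Nat.le_ceil r, rfl⟩ ?_
  rintro _ ⟨a, b, hab, rfl⟩
  exact (mul_le_mul_of_nonneg_left (Real.rpow_le_rpow hr0.le hab hα) hc.le).trans
    (hf a b (hr₀.trans hab))

end Compression

/-! ### The compression of a cubulated group -/

section WordMetric

variable {G : Type u} [Group G] {S : Set G}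

theorem exists_dist_eq_natCast [Infinite G] (hS : Subgroup.closure S = ⊤) (hfin : S.Finite)
    (n : ℕ) : ∃ x y : G, (wordMetric S hS).dist x y = n := by
  obtain ⟨g, hg⟩ := exists_wordDist_eq hS hfin n
  exact ⟨1, g, congrArg Nat.cast hg⟩

/-- A map on a group that is bounded on the edges of the Cayley graph is Lipschitz. -/
theorem dist_le_mul_mulCayley_dist {H : Type v} [PseudoMetricSpace H]
    (hS : Subgroup.closure S = ⊤) {f : G → H} {L : ℝ}
    (hf : ∀ g, ∀ s ∈ S, dist (f g) (f (g * s)) ≤ L) (x y : G) :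
    dist (f x) (f y) ≤ L * (SimpleGraph.mulCayley S).dist x y := by
  obtain ⟨p, hp⟩ := (mulCayley_connected S hS).exists_walk_length_eq_dist x y
  rw [← hp]
  clear hp
  induction p with
  | nil => simp
  | @cons x z y hadj p ih =>
    have h : dist (f x) (f z) ≤ L := by
      obtain ⟨-, s, hs, h | h⟩ := (SimpleGraph.mulCayley_adj' S _ _).1 hadj
      · exact h ▸ hf x s hs
      · rw [dist_comm]
        exact h ▸ hf z s hs
    rw [SimpleGraph.Walk.length_cons]
    push_cast
    linarith [dist_triangle (f x) (f z) (f y)]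

end WordMetric

namespace FlagSquareComplex

theorem IsPath.dist_le {V : Type*} {E : Type w} {C : FlagSquareComplex V E} {H : Type v}
    [PseudoMetricSpace H] {f : V → H} {L : ℝ} (hL : ∀ e, dist (f (C.src e)) (f (C.tgt e)) ≤ L)
    {x y : V} {w : List E} (hw : C.IsPath x w y) : dist (f x) (f y) ≤ L * w.length := by
  induction w generalizing x with
  | nil => rw [show x = y from hw]; simp
  | cons e w ih =>
    have h1 := ih hw.2
    have h2 := hL e
    rw [show C.src e = x from hw.1] at h2
    rw [List.length_cons]
    push_cast
    linarith [dist_triangle (f x) (f (C.tgt e)) (f y)]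

end FlagSquareComplex

namespace CubeComplex

theorem IsCAT0.nonempty_vertex {X : Type w} [TopologicalSpace X] {K : CubeComplex X}
    (hK : K.IsCAT0) : Nonempty K.Vertex := by
  have := hK.simplyConnected
  obtain ⟨x⟩ := (inferInstance : Nonempty X)
  obtain ⟨n, c, hc, -⟩ := K.exists_cube x
  exact ⟨⟨_, corner_mem hc fun _ => false⟩⟩

variable {X : Type w} [TopologicalSpace X] {K : CubeComplex X} {G : Type u} [Group G]
  [MulAction G X] {S : Set G}

/-- Orbit maps composed with the weighted embeddings of the vertices show that the compression is
at least every exponent below `1`. -/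
theorem exists_largeScaleLipschitz [Infinite G] [ProperlyDiscontinuousSMul G X] (hfin : S.Finite)
    (hS : Subgroup.closure S = ⊤) (hK : K.IsCAT0) (hcub : K.IsCubicalAction G)
    (hco : IsCocompactAction G X) {ε : ℝ} (h0 : 0 < ε) (h1 : ε < 1 / 2) :
    letI := wordMetric S hS
    ∃ (H : Type v) (_ : NormedAddCommGroup H) (_ : InnerProductSpace ℝ H) (_ : CompleteSpace H)
      (f : G → H), LargeScaleLipschitz f ∧ ((ε + 1 / 2 : ℝ) : EReal) ≤ asymptoticCompression f := by
  let _ := wordMetric S hS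
  have hnpc := hK.nonpositivelyCurved
  have hC := hK.simplyConn
  obtain ⟨x₀⟩ := hK.nonempty_vertex
  have := countable_of_finite_generators hS hfin
  have := countable_edge hcub hco
  have : Countable (flagSquareComplex hnpc).Wall :=
    inferInstanceAs (Countable (Quot _))
  obtain ⟨N, hN0, hN⟩ := exists_card_edges_at_le hnpc hcub hco
  obtain ⟨H, i1, i2, i3, f, ⟨L, hL⟩, c, hc, hf⟩ :=
    hC.exists_hilbert_embedding hN0 (finite_edges_at hnpc hcub hco) hN x₀ h0 h1
  obtain ⟨M, hM⟩ := exists_dist_le hS hnpc hcub hco x₀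
  refine ⟨H, i1, i2, i3, fun g => f (smulVertex hcub g x₀), ?_, ?_⟩
  · choose w hw using fun s : G => (hC.exists_geodesic x₀ (smulVertex hcub s x₀))
    obtain ⟨m, hm⟩ := (hfin.image fun s => (w s).length).bddAbove
    refine ⟨|L| * m + 1, 0, by positivity, le_rfl, fun x y => ?_⟩
    rw [add_zero]
    refine dist_le_mul_mulCayley_dist hS (f := fun g => f (smulVertex hcub g x₀))
      (fun g s hs => ?_) x y
    rw [smulVertex_mul]
    have h2 := FlagSquareComplex.IsPath.dist_le (f := f) hL (isPath_smul hnpc hcub (g := g) (hw s).1)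
    rw [List.length_map] at h2
    have h3 : ((w s).length : ℝ) ≤ m := Nat.cast_le.2 (hm (mem_image_of_mem _ hs))
    have h4 : L * (w s).length ≤ |L| * m :=
      mul_le_mul (le_abs_self L) h3 (Nat.cast_nonneg _) (abs_nonneg L)
    linarith
  · have hM' : ∀ g h, dist g h ≤
        (M + 1) * (((hC.sep (smulVertex hcub g x₀) (smulVertex hcub h x₀)).ncard : ℝ) + 1) := by
      intro g h
      obtain ⟨w, hw, -, hl⟩ := hC.exists_geodesic (smulVertex hcub g x₀) (smulVertex hcub h x₀)
      have h2 : (((SimpleGraph.mulCayley S).dist g h : ℕ) : ℝ) ≤ ((M * (w.length + 1) : ℕ) : ℝ) :=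
        Nat.cast_le.2 (hM g h w hw)
      rw [hl] at h2
      push_cast at h2
      change (((SimpleGraph.mulCayley S).dist g h : ℕ) : ℝ) ≤ _
      nlinarith
    -- at distances of at least `2 * (M + 1)` the affine estimate `hM'` yields a linear one
    have hM0 : (0 : ℝ) < 2 * (M + 1) := by positivity
    refine le_asymptoticCompression (c := c * (1 / (2 * (M + 1))) ^ (ε + 1 / 2))
      (r₀ := 2 * (M + 1)) (by positivity) (by positivity) (exists_dist_eq_natCast hS hfin)
      fun g h hgh => ?_
    refine le_trans ?_ (hf _ _)
    rw [mul_assoc, ← Real.mul_rpow (by positivity) dist_nonneg]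
    refine mul_le_mul_of_nonneg_left (Real.rpow_le_rpow (by positivity) ?_ (by positivity)) hc.le
    rw [one_div, inv_mul_le_iff₀ hM0]
    nlinarith [hM' g h]

end CubeComplex

theorem mainTheorem2 {G : Type u} [Group G] [Infinite G]
    (S : Set G) (hfin : S.Finite) (hgen : Subgroup.closure S = ⊤)
    {X : Type w} [TopologicalSpace X] (K : CubeComplex X) (hK : K.IsCAT0)
    [MulAction G X] (hcub : K.IsCubicalAction G)
    (hproper : ProperlyDiscontinuousSMul G X) (hcocompact : IsCocompactAction G X) :
    @hilbertSpaceCompression.{u, v} G (wordMetric S hgen) = 1 := by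
  let _ := wordMetric S hgen
  refine le_antisymm (sSup_le ?_) (le_of_forall_lt fun β hβ => ?_)
  · rintro _ ⟨H, _, _, _, f, hf, rfl⟩
    exact asymptoticCompression_le_one (exists_dist_eq_natCast hgen hfin) hf
  · obtain ⟨γ, hβγ, hγ⟩ := EReal.lt_iff_exists_real_btwn.1 hβ
    have hγ1 : γ < 1 := by exact_mod_cast hγ
    -- an exponent `ε < 1 / 2` with `γ ≤ ε + 1 / 2`
    have h1 : max (γ - 1 / 2) (1 / 4) < 1 / 2 := max_lt (by linarith) (by norm_num)
    obtain ⟨H, i1, i2, i3, f, hf, h⟩ := CubeComplex.exists_largeScaleLipschitz.{u, v, w} hfin hgen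
      hK hcub hcocompact (lt_of_lt_of_le (by norm_num) (le_max_right _ _)) h1
    refine hβγ.trans_le (le_trans (EReal.coe_le_coe_iff.2 ?_)
      (h.trans (le_sSup ⟨H, i1, i2, i3, f, hf, rfl⟩)))
    linarith [le_max_left (γ - 1 / 2) (1 / 4)]
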